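/- **Setting.** Let $M,N\ge 1$ (numbers of reflecting elements) and $n_{b_1},n_{b_2}\ge 1$ (numbers of quantization bits) be integers, and let $\overline\gamma_{SR},\overline\gamma_{RD},\overline\gamma_{RE},\overline\gamma_{JE}>0$ be real numbers (average SNRs). For $l=1,2$ let $\xi^{(l)}$ be uniform on $[-\pi/2^{n_{b_l}},\pi/2^{n_{b_l}}]$, put $\varphi_{l,k}=\mathbb E[e^{\mathrm i k\xi^{(l)}}]\in\mathbb R$, and, with $(\mathcal K,l)=(M,1)$ for $UV=SR$ and $(\mathcal K,l)=(N,2)$ for $UV=RD$, $$m_{UV}=\frac{\mathcal K}{2}\,\frac{\varphi_{l,1}^2\,\pi^2/16}{1+\varphi_{l,2}-2\varphi_{l,1}^2\,\pi^2/16},\qquad \Omega_{UV}=\Big(\frac{\mathcal K\pi\varphi_{l,1}}{4}\Big)^2 .$$ *Gamma/Exponential approximation.* Let $\gamma_{SR},\gamma_{RD},\Gamma_{RE},\Gamma_{JE}$ be mutually independent random variables, where $\gamma_{UV}$ is Gamma distributed with shape $m_{UV}$ and scale $\Omega_{UV}\overline\gamma_{UV}/m_{UV}$, and $\Gamma_{UE}$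 is exponential with mean $N\overline\gamma_{UE}$ for $U\in\{R,J\}$. Put $\gamma_{RE}=\Gamma_{RE}/(\Gamma_{JE}+1)$, $\gamma_{eq}=\min(\gamma_{SR},\gamma_{RD})$, $C_s=\log_2(1+\gamma_{eq})-\log_2(1+\gamma_{RE})$ and $P_{int}=\Pr[C_s<0]$. *Bivariate Fox $H$-function.* For $x,y>0$ and reals $c_1,c_2$, it is the double Mellin–Barnes integral $$H(x,y\mid\Lambda)=\frac1{(2\pi \mathrm i)^2}\int_{\operatorname{Re}s=c_1}\int_{\operatorname{Re}v=c_2}\Phi(s,v)\,\Theta_1(s)\,\Theta_2(v)\,x^{-s}y^{-v}\,dv\,ds$$ with the gamma quotients $\Phi,\Theta_1,\Theta_2$ determined by the parameter array $\Lambda$; a numerator upper parameter $(a,\alpha,A)$ contributes $\Gamma(1-a-\alpha s-Av)$ to $\Phi$, a numerator lower parameter $(b,\beta)$ contributes $\Gamma(b+\beta s)$, and a denominator upper parameter $(a,\alpha)$ contributes $1/\Gamma(a+\alpha s)$ to $\Theta_1$ (similarly $\Theta_2$, with $v$). For the two arrays $$\Lambda_1(k,l)=\left(\begin{array}{c}(2-k+l,-1,-1),(-l,1,1);-:-;(1,1):-;(1,1)\\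 -:(0,1),(m_{SR},1);-:(0,1),(m_{RD},1);-\end{array}\right),$$ $$\Lambda_2(k,l)=\left(\begin{array}{c}(k+l,1,1);-:-;(1,1):-;(1,1)\\ -:(0,1),(m_{SR},1);-:(0,1),(m_{RD},1);-\end{array}\right)$$ (in each group, numerator parameters stand before the semicolon and denominator parameters after it; the first row lists upper and the second row lower parameters) this means $\Theta_1(s)=\frac{\Gamma(s)\Gamma(m_{SR}+s)}{\Gamma(1+s)}$, $\Theta_2(v)=\frac{\Gamma(v)\Gamma(m_{RD}+v)}{\Gamma(1+v)}$, and $\Phi(s,v)=\Gamma(k-1-l+s+v)\,\Gamma(1+l-s-v)$ for $\Lambda_1(k,l)$, $\Phi(s,v)=\Gamma(1-k-l-s-v)$ for $\Lambda_2(k,l)$. **Proposition.** Under the Gamma/Exponential approximation, $$P_{int}=1-\int_0^\infty F^{(c)}_{\gamma_{eq}}(x)\,f_{\gamma_{RE}}(x)\,dx,$$ where $$F^{(c)}_{\gamma_{eq}}(x)=\prod_{UV\in\{SR,RD\}}\frac{\Gamma_{\rm inc}\big(m_{UV},\frac{m_{UV}}{\Omega_{UV}\overline\gamma_{UV}}x\big)}{\Gamma(m_{UV})},\qquad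 f_{\gamma_{RE}}(x)=\frac{e^{-x/(N\overline\gamma_{RE})}\,[\overline\gamma_{JE}N\overline\gamma_{RE}+\overline\gamma_{RE}+\overline\gamma_{JE}x]}{N(\overline\gamma_{RE}+\overline\gamma_{JE}x)^2}$$ and $\Gamma_{\rm inc}(a,x)=\int_x^\infty t^{a-1}e^{-t}\,dt$. Moreover, for all $c_1,c_2>0$ with $c_1+c_2<1$, with $H$ taken along the contours $\operatorname{Re}s=c_1$, $\operatorname{Re}v=c_2$, $$P_{int}=1-\frac{1}{\Gamma(m_{SR})\Gamma(m_{RD})}\sum_{l=0}^\infty\Big(\frac{-1}{N\overline\gamma_{JE}}\Big)^l\Bigg[\sum_{k=1}^2\frac{1}{l!\,(N\overline\gamma_{JE})^{2-k}}\,H^{0,2;2,0;2,0}_{2,0;1,2;1,2}\Big(\tfrac{m_{SR}\overline\gamma_{RE}}{\Omega_{SR}\overline\gamma_{SR}\overline\gamma_{JE}},\tfrac{m_{RD}\overline\gamma_{RE}}{\Omega_{RD}\overline\gamma_{RD}\overline\gamma_{JE}}\Big|\Lambda_1(k,l)\Big)$$ $$\qquad\qquad+\frac1{N\overline\gamma_{JE}}\sum_{k=1}^2(1+l)^{k-1}\,H^{0,1;2,0;2,0}_{1,0;1,2;1,2}\Big(\tfrac{Nm_{SR}\overline\gamma_{RE}}{\Omega_{SR}\overline\gamma_{SR}},\tfrac{Nm_{RD}\overline\gamma_{RE}}{\Omega_{RD}\overline\gamma_{RD}}\Big|\Lambda_2(k,l)\Big)\Bigg],$$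 where the integral over $x$, the double integrals that define the $H$-functions, and the series over $l$ all converge absolutely. -/

import Mathlib

open MeasureTheory ProbabilityTheory

/-- Parameter array of a bivariate Fox `H`-function
`H^{m₁,n₁; m₂,n₂; m₃,n₃}_{p₁,q₁; p₂,q₂; p₃,q₃}`. The `joint` entries `(a, α, A)` belong to gamma
factors that depend on both variables, the `fst` and `snd` entries `(c, γ)` to those that depend on
the first or the second variable only. In each of the three groups, `UpperNum` and `UpperDen` are
the first `n` and the remaining `p - n` upper parameters, `LowerNum` and `LowerDen` the first `m`
and the remaining `q - m` lower parameters. -/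
structure FoxHParams where
  jointUpperNum : List (ℝ × ℝ × ℝ)
  jointUpperDen : List (ℝ × ℝ × ℝ)
  jointLowerNum : List (ℝ × ℝ × ℝ)
  jointLowerDen : List (ℝ × ℝ × ℝ)
  fstUpperNum : List (ℝ × ℝ)
  fstUpperDen : List (ℝ × ℝ)
  fstLowerNum : List (ℝ × ℝ)
  fstLowerDen : List (ℝ × ℝ)
  sndUpperNum : List (ℝ × ℝ)
  sndUpperDen : List (ℝ × ℝ)
  sndLowerNum : List (ℝ × ℝ)
  sndLowerDen : List (ℝ × ℝ)

noncomputable section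

/-- The gamma quotient of one variable
`∏ Γ(b + β s) ∏ Γ(1 - a - α s) / (∏ Γ(a + α s) ∏ Γ(1 - b - β s))`. -/
def gammaQuotient (upperNum upperDen lowerNum lowerDen : List (ℝ × ℝ)) (s : ℂ) : ℂ :=
  ((lowerNum.map fun b => Complex.Gamma (b.1 + b.2 * s)).prod *
      (upperNum.map fun a => Complex.Gamma (1 - a.1 - a.2 * s)).prod) /
    ((upperDen.map fun a => Complex.Gamma (a.1 + a.2 * s)).prod *
      (lowerDen.map fun b => Complex.Gamma (1 - b.1 - b.2 * s)).prod)

/-- The gamma quotient of two variables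
`∏ Γ(b + β s + B v) ∏ Γ(1 - a - α s - A v) / (∏ Γ(a + α s + A v) ∏ Γ(1 - b - β s - B v))`. -/
def jointGammaQuotient (upperNum upperDen lowerNum lowerDen : List (ℝ × ℝ × ℝ)) (s v : ℂ) : ℂ :=
  ((lowerNum.map fun b => Complex.Gamma (b.1 + b.2.1 * s + b.2.2 * v)).prod *
      (upperNum.map fun a => Complex.Gamma (1 - a.1 - a.2.1 * s - a.2.2 * v)).prod) /
    ((upperDen.map fun a => Complex.Gamma (a.1 + a.2.1 * s + a.2.2 * v)).prod *
      (lowerDen.map fun b => Complex.Gamma (1 - b.1 - b.2.1 * s - b.2.2 * v)).prod)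

/-- The integrand of the double Mellin–Barnes integral of the bivariate Fox `H`-function. -/
def foxHIntegrand (Λ : FoxHParams) (x y : ℝ) (s v : ℂ) : ℂ :=
  jointGammaQuotient Λ.jointUpperNum Λ.jointUpperDen Λ.jointLowerNum Λ.jointLowerDen s v *
    gammaQuotient Λ.fstUpperNum Λ.fstUpperDen Λ.fstLowerNum Λ.fstLowerDen s *
    gammaQuotient Λ.sndUpperNum Λ.sndUpperDen Λ.sndLowerNum Λ.sndLowerDen v *
    (x : ℂ) ^ (-s) * (y : ℂ) ^ (-v)

/-- The point `c + i t` of the vertical line `Re s = c`. -/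
def onLine (c t : ℝ) : ℂ := c + t * Complex.I

/-- The integrand, on the contours `Re s = c₁` and `Re v = c₂` parametrized by height. -/
def foxHLineIntegrand (c₁ c₂ : ℝ) (Λ : FoxHParams) (x y : ℝ) (t : ℝ × ℝ) : ℂ :=
  foxHIntegrand Λ x y (onLine c₁ t.1) (onLine c₂ t.2)

/-- The bivariate Fox `H`-function
`(2πi)⁻² ∫_{Re s = c₁} ∫_{Re v = c₂} (gamma quotients) x^{-s} y^{-v} dv ds`; with `s = c₁ + i t₁` and
`v = c₂ + i t₂` one has `ds dv = i² dt₁ dt₂`. -/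
def foxH (c₁ c₂ : ℝ) (Λ : FoxHParams) (x y : ℝ) : ℂ :=
  (1 / (2 * Real.pi * Complex.I) ^ 2) *
    ∫ t : ℝ × ℝ, foxHLineIntegrand c₁ c₂ Λ x y t * Complex.I ^ 2

/-- The parameter array `Λ₁(k, l)`. -/
def Lambda1 (mSR mRD : ℝ) (k l : ℕ) : FoxHParams where
  jointUpperNum := [(2 - (k : ℝ) + l, -1, -1), (-(l : ℝ), 1, 1)]
  jointUpperDen := []
  jointLowerNum := []
  jointLowerDen := []
  fstUpperNum := []
  fstUpperDen := [(1, 1)]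
  fstLowerNum := [(0, 1), (mSR, 1)]
  fstLowerDen := []
  sndUpperNum := []
  sndUpperDen := [(1, 1)]
  sndLowerNum := [(0, 1), (mRD, 1)]
  sndLowerDen := []

/-- The parameter array `Λ₂(k, l)`. -/
def Lambda2 (mSR mRD : ℝ) (k l : ℕ) : FoxHParams where
  jointUpperNum := [((k : ℝ) + l, 1, 1)]
  jointUpperDen := []
  jointLowerNum := []
  jointLowerDen := []
  fstUpperNum := []
  fstUpperDen := [(1, 1)]
  fstLowerNum := [(0, 1), (mSR, 1)]
  fstLowerDen := []
  sndUpperNum := []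
  sndUpperDen := [(1, 1)]
  sndLowerNum := [(0, 1), (mRD, 1)]
  sndLowerDen := []

/-- Law of the phase quantization error with `b` bits: uniform on `[-π/2^b, π/2^b]`. -/
def pqeLaw (b : ℕ) : Measure ℝ :=
  volume[|Set.Icc (-(Real.pi / 2 ^ b)) (Real.pi / 2 ^ b)]

/-- The moment `φ_k = E[exp(i k ξ)]` of the phase quantization error, which is real because the law
is symmetric. -/
def pqeMoment (b k : ℕ) : ℝ :=
  (∫ ξ, Complex.exp (Complex.I * k * ξ) ∂(pqeLaw b)).re

/-- Shape parameter `m_UV` of a hop assisted by `K` elements with `b` quantization bits. -/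
def shapeParam (K b : ℕ) : ℝ :=
  (K / 2) * (pqeMoment b 1 ^ 2 * (Real.pi ^ 2 / 16) /
    (1 + pqeMoment b 2 - 2 * pqeMoment b 1 ^ 2 * (Real.pi ^ 2 / 16)))

/-- Average equivalent fading power `Ω_UV` of a hop. -/
def fadingPower (K b : ℕ) : ℝ := (K * Real.pi * pqeMoment b 1 / 4) ^ 2

/-- Upper incomplete gamma function. -/
def upperGamma (a x : ℝ) : ℝ := ∫ t in Set.Ioi x, t ^ (a - 1) * Real.exp (-t)

/-- CCDF of a per-hop SNR with shape `m`, fading power `Ω` and average SNR `g`. -/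
def hopCCDF (m Ω g z : ℝ) : ℝ := upperGamma m (m / (Ω * g) * z) / Real.Gamma m

/-- PDF of the eavesdropper's SINR. -/
def sinrPDF (N : ℕ) (gRE gJE z : ℝ) : ℝ :=
  Real.exp (-(z / (N * gRE))) * (gJE * N * gRE + gRE + gJE * z) / (N * (gRE + gJE * z) ^ 2)

/-- The integrand `F^c_{γ_eq}(x) f_{γ_RE}(x)`, where `F^c_{γ_eq} = F^c_{γ_SR} F^c_{γ_RD}`. -/
def ipIntegrand (N : ℕ) (mSR mRD ΩSR ΩRD gSR gRD gRE gJE x : ℝ) : ℝ :=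
  hopCCDF mSR ΩSR gSR x * hopCCDF mRD ΩRD gRD x * sinrPDF N gRE gJE x

/-- The intercept probability `1 - ∫₀^∞ F^c_{γ_eq}(x) f_{γ_RE}(x) dx`. -/
def interceptProb (N : ℕ) (mSR mRD ΩSR ΩRD gSR gRD gRE gJE : ℝ) : ℝ :=
  1 - ∫ x in Set.Ioi 0, ipIntegrand N mSR mRD ΩSR ΩRD gSR gRD gRE gJE x

/-- The secrecy capacity `C_s = log₂(1 + min(γ_SR, γ_RD)) - log₂(1 + γ_RE)`. -/
def secrecyCapacity (γSR γRD γRE : ℝ) : ℝ :=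
  Real.logb 2 (1 + min γSR γRD) - Real.logb 2 (1 + γRE)

/-- The `l`-th term of the series, for Mellin–Barnes contours `Re s = c₁` and `Re v = c₂`. -/
def ipTerm (c₁ c₂ : ℝ) (N : ℕ) (mSR mRD ΩSR ΩRD gSR gRD gRE gJE : ℝ) (l : ℕ) : ℂ :=
  (-1 / ((N : ℂ) * gJE)) ^ l *
    ((∑ k ∈ Finset.Icc 1 2, 1 / ((l.factorial : ℂ) * ((N : ℂ) * gJE) ^ (2 - k)) *
        foxH c₁ c₂ (Lambda1 mSR mRD k l)
          (mSR * gRE / (ΩSR * gSR * gJE)) (mRD * gRE / (ΩRD * gRD * gJE))) +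
      1 / ((N : ℂ) * gJE) * ∑ k ∈ Finset.Icc 1 2, (1 + (l : ℂ)) ^ (k - 1) *
        foxH c₁ c₂ (Lambda2 mSR mRD k l)
          (N * mSR * gRE / (ΩSR * gSR)) (N * mRD * gRE / (ΩRD * gRD)))

end

/-! ### Moments of the phase quantization error -/

/-! The probabilistic half is conditioning: given that the SINR equals `x`, both hop SNRs are at
least `x` with probability the product of their survival functions, and
`lintegral_exp_div_exp_add_one` supplies the density of the SINR.

For the series, put `z = 1 / (N gJE)` and measure `x` in units of `gRE / gJE`, so that the density
becomes `sinrKernel z`. Each incomplete gamma function is the inverse Mellin transform of `Γ(a + s)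
/ s` (`upperGamma_eq_integral_onLine`). After Fubini the variable `u` enters only through `u ^ (-w)`
with `w = s + v`, which leaves the Mellin transform of the kernel at `1 - w`
(`integral_sinrKernel_mul_upperGamma`). The kernel is itself a Laplace transform, so this equals
`e^z Γ(1 - w) (Γ(1 + w) - γ(1 + w, z))`, with `γ` the lower incomplete gamma function
(`hasMellin_sinrKernel`). Convergence at `u = 0` is what requires `c₁ + c₂ < 1`.

Both pieces are expanded in powers of `z` (`hasSum_sinrMellinTerm`): the exponential series gives
the `Λ₁` terms, and the series of `γ(1 + w, z)` gives the `Λ₂` terms. The reflection formula turns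
the coefficients into the joint gamma factors of the two arrays (`sinrMellinTerm_eq`). A summable
bound depending only on `Re w` permits integration term by term (`hasSum_integral_barnesTerm`). -/

lemma quantizationStep_pos (b : ℕ) : 0 < Real.pi / 2 ^ b := by positivity

lemma quantizationStep_le {b : ℕ} (hb : 1 ≤ b) : Real.pi / 2 ^ b ≤ Real.pi / 2 := by
  have h : (2 : ℝ) ≤ 2 ^ b := by
    calc (2 : ℝ) = 2 ^ 1 := by norm_num
      _ ≤ 2 ^ b := pow_le_pow_right₀ (by norm_num) hb
  gcongr

lemma isProbabilityMeasure_pqeLaw (b : ℕ) : IsProbabilityMeasure (pqeLaw b) := by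
  refine cond_isProbabilityMeasure_of_finite ?_ ?_
  · rw [Real.volume_Icc]
    simp only [ne_eq, ENNReal.ofReal_eq_zero, not_le]
    linarith [quantizationStep_pos b]
  · simp [Real.volume_Icc]

lemma integrable_cos_pqeLaw (b : ℕ) (k : ℝ) :
    Integrable (fun ξ : ℝ => Real.cos (k * ξ)) (pqeLaw b) := by
  have := isProbabilityMeasure_pqeLaw b
  refine Integrable.of_bound (C := 1) (by fun_prop) (ae_of_all _ fun ξ => ?_)
  exact Real.abs_cos_le_one _

lemma pqeMoment_eq_integral_cos (b k : ℕ) :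
    pqeMoment b k = ∫ ξ, Real.cos (k * ξ) ∂(pqeLaw b) := by
  have := isProbabilityMeasure_pqeLaw b
  have hi : Integrable (fun ξ : ℝ => Complex.exp (Complex.I * k * ξ)) (pqeLaw b) := by
    refine Integrable.of_bound (C := 1) (by fun_prop) (ae_of_all _ fun ξ => ?_)
    simp [Complex.norm_exp]
  rw [pqeMoment]
  refine (integral_re hi).symm.trans ?_
  refine integral_congr_ae (ae_of_all _ fun ξ => ?_)
  simp [Complex.exp_re]

/-- The moment is a positive multiple of `sin (π / 2 ^ b)`. At least one bit is needed: for `b = 0`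
the sine vanishes. -/
lemma pqeMoment_one_pos {b : ℕ} (hb : 1 ≤ b) : 0 < pqeMoment b 1 := by
  have h0 := quantizationStep_pos b
  have h1 := quantizationStep_le hb
  rw [pqeMoment_eq_integral_cos, pqeLaw, ProbabilityTheory.cond, integral_smul_measure,
    integral_Icc_eq_integral_Ioc, ← intervalIntegral.integral_of_le (by linarith)]
  simp only [Nat.cast_one, one_mul, integral_cos, Real.sin_neg, sub_neg_eq_add, smul_eq_mul]
  have hs : 0 < Real.sin (Real.pi / 2 ^ b) :=
    Real.sin_pos_of_pos_of_lt_pi h0 (by linarith [Real.pi_pos])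
  refine mul_pos (ENNReal.toReal_pos ?_ ?_) (by linarith)
  · simp [Real.volume_Icc]
  · rw [Real.volume_Icc]
    simp only [ne_eq, ENNReal.inv_eq_top, ENNReal.ofReal_eq_zero, not_le]
    linarith

/-- The variance of `cos ξ` is nonnegative, and `2 cos² ξ = 1 + cos 2ξ`. -/
lemma two_mul_sq_pqeMoment_one_le (b : ℕ) : 2 * pqeMoment b 1 ^ 2 ≤ 1 + pqeMoment b 2 := by
  have := isProbabilityMeasure_pqeLaw b
  have h1 : pqeMoment b 1 = ∫ ξ, Real.cos (1 * ξ) ∂(pqeLaw b) := by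
    simpa using pqeMoment_eq_integral_cos b 1
  have h2 : pqeMoment b 2 = ∫ ξ, Real.cos (2 * ξ) ∂(pqeLaw b) := by
    simpa using pqeMoment_eq_integral_cos b 2
  have hI1 := integrable_cos_pqeLaw b 1
  have hI2 := integrable_cos_pqeLaw b 2
  have h3 : 0 ≤ ∫ ξ, (Real.cos (1 * ξ) - pqeMoment b 1) ^ 2 ∂(pqeLaw b) :=
    integral_nonneg fun ξ => sq_nonneg _
  have h4 : ∀ ξ : ℝ, (Real.cos (1 * ξ) - pqeMoment b 1) ^ 2 =
      (1 / 2 + pqeMoment b 1 ^ 2) + (1 / 2) * Real.cos (2 * ξ)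
        - (2 * pqeMoment b 1) * Real.cos (1 * ξ) := by
    intro ξ
    rw [Real.cos_two_mul, one_mul]
    ring
  simp_rw [h4] at h3
  rw [integral_sub (by exact (integrable_const _).add (hI2.const_mul _)) (hI1.const_mul _),
    integral_add (integrable_const _) (hI2.const_mul _), integral_const_mul, integral_const_mul,
    ← h1, ← h2] at h3
  simp only [integral_const, probReal_univ, one_smul] at h3
  nlinarith

/-- Since `π² / 16 < 1`, the variance inequality makes the denominator strictly positive. -/
lemma shapeParam_pos {K b : ℕ} (hK : 1 ≤ K) (hb : 1 ≤ b) : 0 < shapeParam K b := by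
  have h1 := pqeMoment_one_pos hb
  have h2 := two_mul_sq_pqeMoment_one_le b
  have hK' : (0 : ℝ) < K := by exact_mod_cast hK
  have hpi : Real.pi ^ 2 / 16 < 1 := by
    have := Real.pi_lt_four
    have := Real.pi_pos
    nlinarith
  have h3 : 2 * pqeMoment b 1 ^ 2 * (Real.pi ^ 2 / 16) < 2 * pqeMoment b 1 ^ 2 := by
    have : 0 < 2 * pqeMoment b 1 ^ 2 := by positivity
    nlinarith
  have h4 : 0 < 1 + pqeMoment b 2 - 2 * pqeMoment b 1 ^ 2 * (Real.pi ^ 2 / 16) := by linarith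
  unfold shapeParam
  positivity

lemma fadingPower_pos {K b : ℕ} (hK : 1 ≤ K) (hb : 1 ≤ b) : 0 < fadingPower K b := by
  have h1 := pqeMoment_one_pos hb
  have hK' : (0 : ℝ) < K := by exact_mod_cast hK
  unfold fadingPower
  positivity

/-! ### Growth of the gamma function on vertical lines -/

lemma norm_Gamma_le_Gamma_re {s : ℂ} (hs : 0 < s.re) : ‖Complex.Gamma s‖ ≤ Real.Gamma s.re := by
  rw [Complex.Gamma_eq_integral hs, Complex.GammaIntegral, Real.Gamma_eq_integral hs]
  refine (norm_integral_le_integral_norm _).trans_eq ?_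
  refine setIntegral_congr_fun measurableSet_Ioi fun x (hx : 0 < x) => ?_
  simp [Complex.norm_cpow_eq_rpow_re_of_pos hx, Complex.norm_exp]

lemma onLine_re (c t : ℝ) : (onLine c t).re = c := by simp [onLine]

lemma onLine_add (c d t u : ℝ) : onLine c t + onLine d u = onLine (c + d) (t + u) := by
  simp [onLine]; ring

lemma onLine_ne_zero {c : ℝ} (hc : 0 < c) (t : ℝ) : onLine c t ≠ 0 := fun h => by
  have := congrArg Complex.re h
  simp [onLine] at this
  linarith

lemma continuous_onLine (c : ℝ) : Continuous (onLine c) := by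
  unfold onLine; fun_prop

lemma differentiableAt_Gamma_of_re_pos {s : ℂ} (hs : 0 < s.re) :
    DifferentiableAt ℂ Complex.Gamma s := by
  refine Complex.differentiableAt_Gamma s fun n h => ?_
  rw [h] at hs
  simp at hs
  linarith [(Nat.cast_nonneg n : (0 : ℝ) ≤ n)]

/-- The Mellin transform `Γ(a + s) / s` of the upper incomplete gamma function `Γ(a, ·)`. -/
noncomputable def upperGammaMellin (a : ℝ) (s : ℂ) : ℂ := Complex.Gamma (a + s) / s

lemma continuous_upperGammaMellin_onLine {a c : ℝ} (ha : 0 < a) (hc : 0 < c) :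
    Continuous fun t => upperGammaMellin a (onLine c t) := by
  unfold upperGammaMellin
  refine Continuous.div ?_ (continuous_onLine c) (onLine_ne_zero hc)
  refine continuous_iff_continuousAt.2 fun t => ?_
  refine ContinuousAt.comp (g := Complex.Gamma) (f := fun t => (a : ℂ) + onLine c t) ?_ ?_
  · refine (differentiableAt_Gamma_of_re_pos ?_).continuousAt
    rw [Complex.add_re, onLine_re, Complex.ofReal_re]; positivity
  · exact (continuous_const.add (continuous_onLine c)).continuousAt

/-- No exponential decay of `Γ` is needed: `|Γ(a + s)| |a + s| = |Γ(a + s + 1)|` is at most `Γ(a + c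
+ 1)` on the line, so `Γ(a + s) / s` is `O(|s|⁻²)`. -/
lemma integrable_upperGammaMellin_onLine {a c : ℝ} (ha : 0 < a) (hc : 0 < c) :
    Integrable fun t => upperGammaMellin a (onLine c t) := by
  refine Integrable.mono' (integrable_inv_one_add_sq.const_mul
    (Real.Gamma (a + c + 1) * (1 + (c ^ 2)⁻¹)))
    (continuous_upperGammaMellin_onLine ha hc).aestronglyMeasurable (ae_of_all _ fun t => ?_)
  have hG : 0 < Real.Gamma (a + c + 1) := Real.Gamma_pos_of_pos (by positivity)
  have hre : ((a : ℂ) + onLine c t).re = a + c := by simp [onLine_re]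
  have hne : (a : ℂ) + onLine c t ≠ 0 := fun h => by
    rw [h] at hre; simp at hre; linarith
  have hsq : ‖onLine c t‖ ^ 2 = c ^ 2 + t ^ 2 := by
    rw [← Complex.normSq_eq_norm_sq, Complex.normSq_apply]; simp [onLine]; ring
  have hs0 : 0 < ‖onLine c t‖ := norm_pos_iff.2 (onLine_ne_zero hc t)
  have hle : ‖onLine c t‖ ≤ ‖(a : ℂ) + onLine c t‖ := by
    rw [← sq_le_sq₀ (norm_nonneg _) (norm_nonneg _), hsq, ← Complex.normSq_eq_norm_sq,
      Complex.normSq_apply]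
    simp [onLine]
    nlinarith [mul_pos ha hc, sq_nonneg a]
  have h1 : ‖Complex.Gamma (a + onLine c t)‖ * ‖(a : ℂ) + onLine c t‖ ≤ Real.Gamma (a + c + 1) := by
    rw [mul_comm, ← norm_mul, ← Complex.Gamma_add_one _ hne]
    refine (norm_Gamma_le_Gamma_re ?_).trans_eq ?_
    · rw [Complex.add_re, hre, Complex.one_re]; positivity
    · rw [Complex.add_re, hre, Complex.one_re]
  have h2 : ‖Complex.Gamma (a + onLine c t)‖ * ‖onLine c t‖ ≤ Real.Gamma (a + c + 1) :=
    (mul_le_mul_of_nonneg_left hle (norm_nonneg _)).trans h1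
  have h3 : ‖upperGammaMellin a (onLine c t)‖ =
      ‖Complex.Gamma (a + onLine c t)‖ * ‖onLine c t‖ / (c ^ 2 + t ^ 2) := by
    rw [upperGammaMellin, norm_div, ← hsq]; field_simp
  rw [h3, mul_assoc]
  have h4 : 1 / (c ^ 2 + t ^ 2) ≤ (1 + (c ^ 2)⁻¹) * (1 + t ^ 2)⁻¹ := by
    rw [← div_eq_mul_inv, div_le_div_iff₀ (by positivity) (by positivity)]
    have : (1 + (c ^ 2)⁻¹) * (c ^ 2 + t ^ 2) = 1 + t ^ 2 + (c ^ 2 + t ^ 2 / c ^ 2) := by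
      field_simp; ring
    rw [this]
    have : 0 ≤ c ^ 2 + t ^ 2 / c ^ 2 := by positivity
    linarith
  rw [div_eq_mul_one_div]
  exact mul_le_mul h2 h4 (by positivity) hG.le

/-! ### Mellin transforms of Laplace transforms -/

/-- Fubini, with inner integral `∫ u ^ (s - 1) e ^ (-uq) du = Γ(s) q ^ (-s)`. Taking norms replaces
`s` by its real part, so `hi` is exactly the absolute integrability required. This serves both the
incomplete gamma function and the SINR kernel. -/
lemma hasMellin_laplace {z : ℝ} (hz : 0 ≤ z) {h : ℝ → ℂ} (hm : Measurable h) {s : ℂ}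
    (hs : 0 < s.re) (hi : IntegrableOn (fun q : ℝ => h q * (q : ℂ) ^ (-s)) (Set.Ioi z)) :
    HasMellin (fun u : ℝ => ∫ q in Set.Ioi z, h q * Complex.exp (-(u * q))) s
      (Complex.Gamma s * ∫ q in Set.Ioi z, h q * (q : ℂ) ^ (-s)) := by
  have hnorm : ∀ q ∈ Set.Ioi z, ∀ u ∈ Set.Ioi (0 : ℝ),
      ‖(u : ℂ) ^ (s - 1) * (h q * Complex.exp (-(u * q)))‖ =
        ‖h q‖ * (u ^ (s.re - 1) * Real.exp (-(q * u))) := by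
    intro q _ u hu
    rw [norm_mul, norm_mul, Complex.norm_cpow_eq_rpow_re_of_pos hu, Complex.norm_exp]
    simp
    ring_nf
  have hval : ∀ q ∈ Set.Ioi z, ∫ u in Set.Ioi (0 : ℝ),
      (u : ℂ) ^ (s - 1) * (h q * Complex.exp (-(u * q))) =
        Complex.Gamma s * (h q * (q : ℂ) ^ (-s)) := by
    intro q hq
    have hq0 : 0 < q := hz.trans_lt hq
    have := Complex.integral_cpow_mul_exp_neg_mul_Ioi hs hq0
    rw [one_div, Complex.inv_cpow _ _ 
      (by rw [Complex.arg_ofReal_of_nonneg hq0.le]; exact Real.pi_pos.ne), ← Complex.cpow_neg] at this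
    calc _ = ∫ u in Set.Ioi (0 : ℝ), h q * ((u : ℂ) ^ (s - 1) * Complex.exp (-(q * u))) := by
            congr 1; ext u; rw [mul_comm (q : ℂ)]; ring
      _ = _ := by rw [integral_const_mul, this]; ring
  have hmeas : Measurable fun p : ℝ × ℝ =>
      (p.1 : ℂ) ^ (s - 1) * (h p.2 * Complex.exp (-(p.1 * p.2))) := by fun_prop
  have hF : Integrable (fun p : ℝ × ℝ =>
      (p.1 : ℂ) ^ (s - 1) * (h p.2 * Complex.exp (-(p.1 * p.2))))
      ((volume.restrict (Set.Ioi 0)).prod (volume.restrict (Set.Ioi z))) := by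
    rw [integrable_prod_iff' hmeas.aestronglyMeasurable]
    constructor
    · filter_upwards [ae_restrict_mem measurableSet_Ioi] with q hq
      have hq0 : 0 < q := hz.trans_lt hq
      have h1 : IntegrableOn (fun u : ℝ => ‖h q‖ * (u ^ (s.re - 1) * Real.exp (-(q * u))))
          (Set.Ioi 0) := by
        have h2 : IntegrableOn (fun u : ℝ => u ^ (s.re - 1) * Real.exp (-(q * u))) (Set.Ioi 0) := by
          simpa using integrableOn_rpow_mul_exp_neg_mul_rpow (p := 1) (s := s.re - 1) (b := q)
            (by linarith) one_pos hq0
        exact Integrable.const_mul h2 _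
      refine Integrable.mono' h1 (by fun_prop) ?_
      filter_upwards [ae_restrict_mem measurableSet_Ioi] with u hu
      exact (hnorm q hq u hu).le
    · refine (hi.norm.const_mul (Real.Gamma s.re)).congr ?_
      filter_upwards [ae_restrict_mem measurableSet_Ioi] with q hq
      have hq0 : 0 < q := hz.trans_lt hq
      rw [setIntegral_congr_fun measurableSet_Ioi (hnorm q hq), integral_const_mul,
        Real.integral_rpow_mul_exp_neg_mul_Ioi hs hq0, norm_mul,
        Complex.norm_cpow_eq_rpow_re_of_pos hq0, one_div, Real.inv_rpow hq0.le,
        Complex.neg_re, Real.rpow_neg hq0.le]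
      ring
  constructor
  · have := hF.integral_prod_left
    refine this.congr (ae_of_all _ fun u => ?_)
    simp only [smul_eq_mul, integral_const_mul]
  · rw [mellin, ← integral_const_mul, ← setIntegral_congr_fun measurableSet_Ioi hval,
      ← integral_integral_swap hF]
    simp only [smul_eq_mul, integral_const_mul]

/-! ### The upper incomplete gamma function as a Mellin–Barnes integral -/

lemma integrableOn_upperGamma_integrand {a : ℝ} (ha : 0 < a) :
    IntegrableOn (fun t : ℝ => t ^ (a - 1) * Real.exp (-t)) (Set.Ioi 0) := by
  simpa [mul_comm] using Real.GammaIntegral_convergent ha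

lemma upperGamma_zero {a : ℝ} (ha : 0 < a) : upperGamma a 0 = Real.Gamma a := by
  rw [upperGamma, Real.Gamma_eq_integral ha]
  simp_rw [mul_comm]

lemma upperGamma_eq_sub {a x : ℝ} (ha : 0 < a) (hx : 0 ≤ x) :
    upperGamma a x =
      Real.Gamma a - ∫ t in (0 : ℝ)..x, t ^ (a - 1) * Real.exp (-t) := by
  rw [← upperGamma_zero ha, upperGamma, upperGamma, eq_sub_iff_add_eq, add_comm]
  exact intervalIntegral.integral_interval_add_Ioi (integrableOn_upperGamma_integrand ha)
    ((integrableOn_upperGamma_integrand ha).mono_set (Set.Ioi_subset_Ioi hx))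

lemma continuousOn_upperGamma {a : ℝ} (ha : 0 < a) : ContinuousOn (upperGamma a) (Set.Ici 0) := by
  -- Extension by zero makes the integrand integrable on the whole line, so the continuity theorem
  -- for primitives applies.
  have hint : Integrable
      ((Set.Ioi (0 : ℝ)).indicator fun t : ℝ => t ^ (a - 1) * Real.exp (-t)) :=
    (integrable_indicator_iff measurableSet_Ioi).2 (integrableOn_upperGamma_integrand ha)
  have hc : Continuous fun x : ℝ => Real.Gamma a - ∫ t in (0 : ℝ)..x,
      (Set.Ioi (0 : ℝ)).indicator (fun t : ℝ => t ^ (a - 1) * Real.exp (-t)) t :=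
    continuous_const.sub (intervalIntegral.continuous_primitive
      (fun _ _ => hint.intervalIntegrable) 0)
  refine hc.continuousOn.congr fun x (hx : 0 ≤ x) => ?_
  rw [upperGamma_eq_sub ha hx]
  congr 1
  rw [intervalIntegral.integral_of_le hx, intervalIntegral.integral_of_le hx]
  refine setIntegral_congr_fun measurableSet_Ioc fun t ht => ?_
  rw [Set.indicator_of_mem (show t ∈ Set.Ioi (0 : ℝ) from ht.1)]

lemma upperGamma_nonneg {a x : ℝ} (hx : 0 ≤ x) : 0 ≤ upperGamma a x :=
  setIntegral_nonneg measurableSet_Ioi fun t (ht : x < t) => by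
    have : 0 < t := hx.trans_lt ht
    positivity

lemma upperGamma_le_Gamma {a x : ℝ} (ha : 0 < a) (hx : 0 ≤ x) :
    upperGamma a x ≤ Real.Gamma a := by
  rw [upperGamma_eq_sub ha hx, sub_le_self_iff]
  refine intervalIntegral.integral_nonneg hx fun t ht => ?_
  have := ht.1
  positivity

/-- Substitute `t = x q`. The prefactor `x ^ a` only shifts the Mellin variable. -/
lemma upperGamma_eq_laplace (a : ℝ) {x : ℝ} (hx : 0 < x) :
    (upperGamma a x : ℂ) = (x : ℂ) ^ (a : ℂ) *
      ∫ q in Set.Ioi (1 : ℝ), (q : ℂ) ^ ((a : ℂ) - 1) * Complex.exp (-(x * q)) := by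
  have h1 := integral_comp_mul_left_Ioi (fun t : ℝ => t ^ (a - 1) * Real.exp (-t)) 1 hx
  rw [mul_one, smul_eq_mul, eq_inv_mul_iff_mul_eq₀ hx.ne', ← upperGamma] at h1
  have h2 : ∫ q in Set.Ioi (1 : ℝ), (q : ℂ) ^ ((a : ℂ) - 1) * Complex.exp (-(x * q)) =
      ((∫ q in Set.Ioi (1 : ℝ), q ^ (a - 1) * Real.exp (-(x * q)) : ℝ) : ℂ) := by
    rw [← integral_complex_ofReal]
    refine setIntegral_congr_fun measurableSet_Ioi fun q (hq : 1 < q) => ?_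
    rw [Complex.ofReal_mul, Complex.ofReal_cpow (by linarith)]
    simp
  rw [h2, ← h1, ← Complex.ofReal_cpow hx.le, ← Complex.ofReal_mul]
  congr 1
  rw [← integral_const_mul, ← integral_const_mul]
  refine setIntegral_congr_fun measurableSet_Ioi fun q (hq : 1 < q) => ?_
  rw [Real.mul_rpow hx.le (by linarith), Real.rpow_sub_one hx.ne']
  field_simp

/-- The Laplace lemma at the shifted point `s + a` gives `Γ(s + a)` times `∫_1^∞ q ^ (-s - 1) dq = 1
/ s`. -/
lemma hasMellin_upperGamma {a : ℝ} (ha : 0 < a) {s : ℂ} (hs : 0 < s.re) :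
    HasMellin (fun x => (upperGamma a x : ℂ)) s (upperGammaMellin a s) := by
  have hre : 0 < (s + a).re := by simp; positivity
  have hfun : ∀ q ∈ Set.Ioi (1 : ℝ),
      (q : ℂ) ^ ((a : ℂ) - 1) * (q : ℂ) ^ (-(s + a)) = (q : ℂ) ^ (-s - 1) := by
    intro q (hq : 1 < q)
    rw [← Complex.cpow_add _ _ (by exact_mod_cast (by linarith : q ≠ 0))]
    congr 1; ring
  have hlt : (-s - 1).re < -1 := by simp; linarith
  have hi : IntegrableOn (fun q : ℝ => (q : ℂ) ^ ((a : ℂ) - 1) * (q : ℂ) ^ (-(s + a)))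
      (Set.Ioi 1) :=
    (integrableOn_Ioi_cpow_of_lt hlt one_pos).congr_fun (fun q hq => (hfun q hq).symm)
      measurableSet_Ioi
  have hM := hasMellin_laplace zero_le_one (h := fun q : ℝ => (q : ℂ) ^ ((a : ℂ) - 1))
    (by fun_prop) hre hi
  have hval : Complex.Gamma (s + a) * ∫ q in Set.Ioi (1 : ℝ),
      (q : ℂ) ^ ((a : ℂ) - 1) * (q : ℂ) ^ (-(s + a)) = upperGammaMellin a s := by
    rw [setIntegral_congr_fun measurableSet_Ioi hfun, integral_Ioi_cpow_of_lt hlt one_pos,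
      upperGammaMellin, add_comm s]
    simp [div_eq_mul_inv]
  rw [hval] at hM
  have heq : Set.EqOn (fun x : ℝ => (x : ℂ) ^ (s - 1) • (upperGamma a x : ℂ))
      (fun x : ℝ => (x : ℂ) ^ (s - 1) • ((x : ℂ) ^ (a : ℂ) •
      ∫ q in Set.Ioi (1 : ℝ), (q : ℂ) ^ ((a : ℂ) - 1) * Complex.exp (-(x * q)))) (Set.Ioi 0) :=
    fun x hx => by simp only [upperGamma_eq_laplace a hx, smul_eq_mul]
  constructor
  · exact (MellinConvergent.cpow_smul.2 hM.1).congr_fun heq.symm measurableSet_Ioi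
  · rw [mellin, setIntegral_congr_fun measurableSet_Ioi heq]
    exact (mellin_cpow_smul _ s a).trans hM.2

theorem upperGamma_eq_integral_onLine {a c x : ℝ} (ha : 0 < a) (hc : 0 < c) (hx : 0 < x) :
    (upperGamma a x : ℂ) = (1 / (2 * Real.pi) : ℂ) *
      ∫ t : ℝ, (x : ℂ) ^ (-onLine c t) * upperGammaMellin a (onLine c t) := by
  have hmel : ∀ t : ℝ, mellin (fun x => (upperGamma a x : ℂ)) (onLine c t) =
      upperGammaMellin a (onLine c t) := fun t =>
    (hasMellin_upperGamma ha (by rwa [onLine_re])).2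
  have hinv := mellinInv_mellin_eq c (fun x => (upperGamma a x : ℂ)) hx
    (hasMellin_upperGamma ha (by simpa using hc)).1
    ((integrable_upperGammaMellin_onLine ha hc).congr (ae_of_all _ fun t => (hmel t).symm))
    (Complex.continuous_ofReal.continuousAt.comp
      ((continuousOn_upperGamma ha).continuousAt (Ici_mem_nhds hx)))
  have hfun : (fun t : ℝ => (x : ℂ) ^ (-onLine c t) * upperGammaMellin a (onLine c t)) =
      fun t : ℝ => (x : ℂ) ^ (-((c : ℂ) + t * Complex.I)) •
        mellin (fun x => (upperGamma a x : ℂ)) ((c : ℂ) + t * Complex.I) :=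
    funext fun t => by rw [← hmel t, smul_eq_mul]; rfl
  rw [← hinv, mellinInv, hfun, Complex.real_smul]
  push_cast
  rfl

/-! ### Mellin transform of the normalized density of the eavesdropper's SINR -/

/-- The density of the eavesdropper's SINR in units of `gRE / gJE`, with `z = 1 / (N gJE)`. -/
noncomputable def sinrKernel (z u : ℝ) : ℝ :=
  Real.exp (-(z * u)) * (z / (1 + u) + 1 / (1 + u) ^ 2)

lemma integral_id_mul_exp_neg_mul_Ioi {b z : ℝ} (hb : 0 < b) (hz : 0 < z) :
    ∫ q in Set.Ioi z, q * Real.exp (-(b * q)) =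
      Real.exp (-(b * z)) * (z / b + 1 / b ^ 2) := by
  have hderiv : ∀ q ∈ Set.Ici z, HasDerivAt
      (fun q : ℝ => -(Real.exp (-(b * q)) * (q / b + 1 / b ^ 2))) (q * Real.exp (-(b * q))) q := by
    intro q _
    have h1 : HasDerivAt (fun q : ℝ => Real.exp (-(b * q))) (Real.exp (-(b * q)) * (-b)) q := by
      have := ((hasDerivAt_id q).const_mul b).fun_neg.exp
      simpa using this
    have h2 : HasDerivAt (fun q : ℝ => q / b + 1 / b ^ 2) (1 / b) q :=
      ((hasDerivAt_id q).div_const b).add_const _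
    convert! (h1.fun_mul h2).fun_neg using 1
    field_simp
    ring
  have hlim : Filter.Tendsto (fun q : ℝ => -(Real.exp (-(b * q)) * (q / b + 1 / b ^ 2)))
      Filter.atTop (nhds 0) := by
    have h1 := tendsto_rpow_mul_exp_neg_mul_atTop_nhds_zero 1 b hb
    have h0 := tendsto_rpow_mul_exp_neg_mul_atTop_nhds_zero 0 b hb
    have := ((h1.mul_const (1 / b)).add (h0.mul_const (1 / b ^ 2))).neg
    simp only [zero_mul, add_zero, neg_zero] at this
    refine this.congr fun q => ?_
    rw [Real.rpow_one, Real.rpow_zero, neg_mul]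
    ring
  rw [integral_Ioi_of_hasDerivAt_of_nonneg' hderiv (fun q (hq : z < q) => by
    have : 0 < q := hz.trans hq
    positivity) hlim]
  ring

/-- The factor `e^z` restores `e ^ (-zu)` from the boundary value `e ^ (-(1 + u) z)` of the
integral. -/
lemma sinrKernel_eq_laplace {z u : ℝ} (hz : 0 < z) (hu : 0 < u) :
    (sinrKernel z u : ℂ) = Complex.exp z *
      ∫ q in Set.Ioi z, (q : ℂ) * Complex.exp (-q) * Complex.exp (-(u * q)) := by
  have h1 : ∫ q in Set.Ioi z, (q : ℂ) * Complex.exp (-q) * Complex.exp (-(u * q)) =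
      ((∫ q in Set.Ioi z, q * Real.exp (-((1 + u) * q)) : ℝ) : ℂ) := by
    rw [← integral_complex_ofReal]
    refine setIntegral_congr_fun measurableSet_Ioi fun q _ => ?_
    push_cast
    rw [mul_assoc, ← Complex.exp_add]
    ring_nf
  rw [h1, integral_id_mul_exp_neg_mul_Ioi (by positivity) hz, sinrKernel, ← Complex.ofReal_exp,
    ← Complex.ofReal_mul, ← mul_assoc, ← Real.exp_add]
  ring_nf

lemma integrableOn_cpow_mul_exp_neg_Ioi {z : ℝ} (hz : 0 ≤ z) {w : ℂ} (hw : 0 < (1 + w).re) :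
    IntegrableOn (fun q : ℝ => Complex.exp (-q) * (q : ℂ) ^ w) (Set.Ioi z) := by
  have := (Complex.GammaIntegral_convergent hw).mono_set (Set.Ioi_subset_Ioi hz)
  simpa [Complex.ofReal_exp] using this

lemma integral_cpow_mul_exp_neg_Ioi {z : ℝ} (hz : 0 ≤ z) {w : ℂ} (hw : 0 < (1 + w).re) :
    ∫ q in Set.Ioi z, Complex.exp (-q) * (q : ℂ) ^ w =
      Complex.Gamma (1 + w) - Complex.partialGamma (1 + w) z := by
  rw [eq_sub_iff_add_eq, add_comm, Complex.Gamma_eq_integral hw, Complex.GammaIntegral,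
    Complex.partialGamma]
  have h := intervalIntegral.integral_interval_add_Ioi
    (integrableOn_cpow_mul_exp_neg_Ioi le_rfl hw) (integrableOn_cpow_mul_exp_neg_Ioi hz hw)
  simpa using h

/-- The Laplace lemma at `1 - w` leaves `∫_z^∞ e ^ (-q) q ^ w dq`, an upper incomplete gamma
function. It is kept as a difference because its two pieces produce the two families of
`H`-functions. -/
lemma hasMellin_sinrKernel {z : ℝ} (hz : 0 < z) {w : ℂ} (hw0 : 0 < w.re) (hw1 : w.re < 1) :
    HasMellin (fun u => (sinrKernel z u : ℂ)) (1 - w)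
      (Complex.exp z * (Complex.Gamma (1 - w) *
        (Complex.Gamma (1 + w) - Complex.partialGamma (1 + w) z))) := by
  have hre : 0 < (1 - w).re := by simp; linarith
  have hre' : 0 < (1 + w).re := by simp; linarith
  have hfun : ∀ q ∈ Set.Ioi z, (q : ℂ) * Complex.exp (-q) * (q : ℂ) ^ (-(1 - w)) =
      Complex.exp (-q) * (q : ℂ) ^ w := by
    intro q (hq : z < q)
    have hq0 : (q : ℂ) ≠ 0 := by exact_mod_cast (hz.trans hq).ne'
    rw [show -(1 - w) = w - 1 by ring, Complex.cpow_sub _ _ hq0, Complex.cpow_one]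
    field_simp
  have hM := hasMellin_laplace hz.le (h := fun q : ℝ => (q : ℂ) * Complex.exp (-q))
    (by fun_prop) hre ((integrableOn_cpow_mul_exp_neg_Ioi hz.le hre').congr_fun
      (fun q hq => (hfun q hq).symm) measurableSet_Ioi)
  rw [setIntegral_congr_fun measurableSet_Ioi hfun, integral_cpow_mul_exp_neg_Ioi hz.le hre'] at hM
  have hM' := hasMellin_const_smul hM.1 (Complex.exp z)
  rw [hM.2] at hM'
  have heq : Set.EqOn (fun u : ℝ => (u : ℂ) ^ (1 - w - 1) • (sinrKernel z u : ℂ))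
      (fun u : ℝ => (u : ℂ) ^ (1 - w - 1) • (Complex.exp z •
      ∫ q in Set.Ioi z, (q : ℂ) * Complex.exp (-q) * Complex.exp (-(u * q)))) (Set.Ioi 0) :=
    fun u hu => by simp only [sinrKernel_eq_laplace hz hu, smul_eq_mul]
  constructor
  · exact IntegrableOn.congr_fun hM'.1 heq.symm measurableSet_Ioi
  · rw [mellin, setIntegral_congr_fun measurableSet_Ioi heq]
    exact hM'.2

/-! ### Series expansion of that Mellin transform -/

/-- The factorial bound `l! ‖Γ(1 + w)‖ ≤ ‖Γ(1 + w + l)‖` on the right half-plane. -/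
lemma factorial_mul_norm_Gamma_le {w : ℂ} (hw : 0 < w.re) (l : ℕ) :
    l.factorial * ‖Complex.Gamma (1 + w)‖ ≤ ‖Complex.Gamma (1 + w + l)‖ := by
  induction l with
  | zero => simp
  | succ l ih =>
    have hre : (l : ℝ) + 1 ≤ (1 + w + l).re := by simp; linarith
    have hne : (1 + w + l : ℂ) ≠ 0 := fun h => by
      rw [h] at hre; simp at hre; linarith [(Nat.cast_nonneg l : (0 : ℝ) ≤ l)]
    have h1 : (1 + w + (l + 1 : ℕ) : ℂ) = 1 + w + l + 1 := by push_cast; ring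
    rw [h1, Complex.Gamma_add_one _ hne, norm_mul, Nat.factorial_succ]
    push_cast
    rw [mul_assoc]
    exact mul_le_mul (hre.trans (Complex.re_le_norm _)) ih (by positivity) (norm_nonneg _)

lemma norm_partialGamma_le {w : ℂ} (hw : 0 < w.re) {z : ℝ} (hz : 0 < z) (n : ℕ) :
    ‖Complex.partialGamma (1 + w + n) z‖ ≤ z ^ (w.re + 1 + n) := by
  rw [Complex.partialGamma]
  refine (intervalIntegral.norm_integral_le_of_norm_le_const (C := z ^ (w.re + n)) ?_).trans ?_
  · intro x hx
    rw [Set.uIoc_of_le hz.le] at hx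
    rw [norm_mul, Complex.norm_cpow_eq_rpow_re_of_pos hx.1, Complex.norm_real, Real.norm_eq_abs,
      Real.abs_exp]
    have h1 : (1 + w + n - 1 : ℂ).re = w.re + n := by simp; ring
    rw [h1]
    have h2 : Real.exp (-x) ≤ 1 := Real.exp_le_one_iff.2 (by linarith [hx.1])
    have h3 : x ^ (w.re + n) ≤ z ^ (w.re + n) :=
      Real.rpow_le_rpow hx.1.le hx.2 (by positivity)
    calc _ ≤ 1 * x ^ (w.re + n) := by
            exact mul_le_mul_of_nonneg_right h2 (Real.rpow_nonneg hx.1.le _)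
      _ ≤ _ := by rw [one_mul]; exact h3
  · rw [sub_zero, abs_of_pos hz, show w.re + 1 + n = w.re + n + 1 by ring, Real.rpow_add_one hz.ne']

/-- Iterates `P(s) = P(s + 1) + z ^ s e ^ (-z) / Γ(s + 1)` for `P(s) = γ(s, z) / Γ(s)`, which is the
recurrence of `γ` divided by `Γ(s + 1)`. -/
lemma partialGamma_div_Gamma {w : ℂ} (hw : 0 < w.re) {z : ℝ} (hz : 0 < z) (n : ℕ) :
    Complex.partialGamma (1 + w) z / Complex.Gamma (1 + w) =
      Complex.exp (-z) * (∑ l ∈ Finset.range n, (z : ℂ) ^ (1 + w + l) / Complex.Gamma (2 + w + l))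
        + Complex.partialGamma (1 + w + n) z / Complex.Gamma (1 + w + n) := by
  induction n with
  | zero => simp
  | succ n ih =>
    have hre : 0 < (1 + w + n).re := by simp; positivity
    have hne : (1 + w + n : ℂ) ≠ 0 := fun h => by rw [h] at hre; simp at hre
    have hG := Complex.Gamma_ne_zero_of_re_pos hre
    have h1 : (1 + w + (n + 1 : ℕ) : ℂ) = 1 + w + n + 1 := by push_cast; ring
    have h2 : (2 + w + n : ℂ) = 1 + w + n + 1 := by ring
    rw [ih, Finset.sum_range_succ, h1, h2, Complex.partialGamma_add_one hre hz.le,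
      Complex.Gamma_add_one _ hne]
    push_cast
    field_simp
    ring

/-- The numerator is at most a constant times `z ^ n`, while the denominator is at least a constant
times `n!`. -/
lemma tendsto_partialGamma_div_Gamma {w : ℂ} (hw : 0 < w.re) {z : ℝ} (hz : 0 < z) :
    Filter.Tendsto (fun n : ℕ => Complex.partialGamma (1 + w + n) z / Complex.Gamma (1 + w + n))
      Filter.atTop (nhds 0) := by
  have hre : 0 < (1 + w).re := by simp; linarith
  have hG : 0 < ‖Complex.Gamma (1 + w)‖ := norm_pos_iff.2 (Complex.Gamma_ne_zero_of_re_pos hre)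
  have hlim := (FloorSemiring.tendsto_pow_div_factorial_atTop z).const_mul
    (z ^ (w.re + 1) / ‖Complex.Gamma (1 + w)‖)
  rw [mul_zero] at hlim
  refine squeeze_zero_norm (fun n => ?_) hlim
  rw [norm_div]
  have hf : (0 : ℝ) < n.factorial := by exact_mod_cast n.factorial_pos
  calc _ ≤ z ^ (w.re + 1 + n) / (n.factorial * ‖Complex.Gamma (1 + w)‖) := by
        exact div_le_div₀ (by positivity) (norm_partialGamma_le hw hz n) (by positivity)
          (factorial_mul_norm_Gamma_le hw n)
    _ = _ := by rw [Real.rpow_add_natCast hz.ne']; field_simp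

/-- The `l`-th term of the expansion of the Mellin transform of `sinrKernel z` at `1 - w`. -/
noncomputable def sinrMellinTerm (z : ℝ) (l : ℕ) (w : ℂ) : ℂ :=
  Complex.Gamma (1 - w) * Complex.Gamma (1 + w) *
    ((z : ℂ) ^ l / l.factorial * ((z + w - l) / w) -
      (z : ℂ) ^ (1 + w + l) / Complex.Gamma (2 + w + l))

/-- A bound for `sinrMellinTerm z l` on the line `Re w = c`. -/
noncomputable def sinrMellinBound (z c : ℝ) (l : ℕ) : ℝ :=
  Real.Gamma (1 - c) * Real.Gamma (1 + c) * (z ^ l / l.factorial * (z / c + 1 + l / c)) +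
    Real.Gamma (1 - c) * (z ^ (1 + c + l) / (l + 1).factorial)

/-- The bound depends on `w` only through `Re w`, hence is uniform on the line; this is what later
lets the sum pass through the double integral. -/
lemma norm_sinrMellinTerm_le {z : ℝ} (hz : 0 < z) {w : ℂ} (hw0 : 0 < w.re) (hw1 : w.re < 1)
    (l : ℕ) : ‖sinrMellinTerm z l w‖ ≤ sinrMellinBound z w.re l := by
  have hm : ‖Complex.Gamma (1 - w)‖ ≤ Real.Gamma (1 - w.re) := by
    have := norm_Gamma_le_Gamma_re (s := 1 - w) (by simp; linarith)
    simpa using this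
  have hp : ‖Complex.Gamma (1 + w)‖ ≤ Real.Gamma (1 + w.re) := by
    have := norm_Gamma_le_Gamma_re (s := 1 + w) (by simp; linarith)
    simpa using this
  have hm0 : 0 < Real.Gamma (1 - w.re) := Real.Gamma_pos_of_pos (by linarith)
  have hp0 : 0 < Real.Gamma (1 + w.re) := Real.Gamma_pos_of_pos (by linarith)
  have hwn : w.re ≤ ‖w‖ := Complex.re_le_norm w
  have hw : 0 < ‖w‖ := hw0.trans_le hwn
  have h1 : ‖(z : ℂ) ^ l / l.factorial * ((z + w - l) / w)‖ ≤
      z ^ l / l.factorial * (z / w.re + 1 + l / w.re) := by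
    rw [norm_mul, norm_div, norm_div, norm_pow, Complex.norm_real, Real.norm_of_nonneg hz.le,
      Complex.norm_natCast]
    gcongr
    have h2 : ‖(z + w - l : ℂ)‖ ≤ z + ‖w‖ + l := by
      refine (norm_sub_le _ _).trans ?_
      rw [Complex.norm_natCast]
      gcongr
      refine (norm_add_le _ _).trans ?_
      rw [Complex.norm_real, Real.norm_of_nonneg hz.le]
    calc _ ≤ (z + ‖w‖ + l) / ‖w‖ := by gcongr
      _ = z / ‖w‖ + 1 + l / ‖w‖ := by field_simp
      _ ≤ _ := by gcongr
  -- `Γ(1 + w)` must stay with the denominator: the ratio `Γ(1 + w) / Γ(2 + w + l)` is at most `1 /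
  -- (l + 1)!` in norm, whereas `1 / Γ(2 + w + l)` alone is unbounded along the line.
  have h3 : ‖Complex.Gamma (1 + w) * ((z : ℂ) ^ (1 + w + l) / Complex.Gamma (2 + w + l))‖ ≤
      z ^ (1 + w.re + l) / (l + 1).factorial := by
    have hG : 0 < ‖Complex.Gamma (1 + w)‖ :=
      norm_pos_iff.2 (Complex.Gamma_ne_zero_of_re_pos (by simp; linarith))
    have h4 := factorial_mul_norm_Gamma_le hw0 (l + 1)
    rw [show (1 + w + (l + 1 : ℕ) : ℂ) = 2 + w + l by push_cast; ring] at h4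
    have hf : (0 : ℝ) < (l + 1).factorial := by exact_mod_cast (l + 1).factorial_pos
    have hG2 : 0 < ‖Complex.Gamma (2 + w + l)‖ := (mul_pos hf hG).trans_le h4
    rw [norm_mul, norm_div, Complex.norm_cpow_eq_rpow_re_of_pos hz]
    have h5 : (1 + w + l : ℂ).re = 1 + w.re + l := by simp
    rw [h5, mul_div_assoc', div_le_div_iff₀ hG2 hf]
    have := mul_le_mul_of_nonneg_left h4 (Real.rpow_nonneg hz.le (1 + w.re + l))
    linarith
  rw [sinrMellinTerm, mul_sub]
  refine (norm_sub_le _ _).trans ?_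
  rw [sinrMellinBound]
  refine add_le_add ?_ ?_
  · rw [norm_mul, norm_mul]
    gcongr
  · rw [mul_assoc, norm_mul]
    gcongr

lemma summable_sinrMellinBound {z : ℝ} (hz : 0 < z) (c : ℝ) : Summable (sinrMellinBound z c) := by
  have h0 : Summable fun l : ℕ => z ^ l / l.factorial := Real.summable_pow_div_factorial z
  have h1 : Summable fun l : ℕ => z ^ l / l.factorial * l := by
    rw [← summable_nat_add_iff 1]
    refine (h0.mul_left z).congr fun l => ?_
    rw [Nat.factorial_succ, pow_succ]
    push_cast
    field_simp
  have h2 : Summable fun l : ℕ => z ^ (1 + c + l) / (l + 1).factorial := by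
    refine (((summable_nat_add_iff 1).2 h0).mul_left (z ^ c)).congr fun l => ?_
    rw [show 1 + c + l = c + (l + 1 : ℕ) by push_cast; ring, Real.rpow_add_natCast hz.ne']
    ring
  refine Summable.add ?_ (h2.mul_left _)
  refine Summable.mul_left _ ?_
  refine ((h0.mul_right (z / c + 1)).add (h1.mul_right (1 / c))).congr fun l => ?_
  ring

theorem hasSum_sinrMellinTerm {z : ℝ} (hz : 0 < z) {w : ℂ} (hw0 : 0 < w.re) (hw1 : w.re < 1) :
    HasSum (fun l => sinrMellinTerm z l w)
      (Complex.exp z * (Complex.Gamma (1 - w) *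
        (Complex.Gamma (1 + w) - Complex.partialGamma (1 + w) z))) := by
  have hs : Summable fun l => sinrMellinTerm z l w :=
    Summable.of_norm_bounded (summable_sinrMellinBound hz w.re)
      (norm_sinrMellinTerm_le hz hw0 hw1)
  have hwne : w ≠ 0 := fun h => by rw [h] at hw0; simp at hw0
  have hG := Complex.Gamma_ne_zero_of_re_pos (s := 1 + w) (by simp; linarith)
  have hexp : HasSum (fun l : ℕ => (z : ℂ) ^ l / l.factorial) (Complex.exp z) := by
    rw [Complex.exp_eq_exp_ℂ]
    exact NormedSpace.expSeries_div_hasSum_exp (z : ℂ)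
  have hexp1 : HasSum (fun l : ℕ => (z : ℂ) ^ l / l.factorial * l) (Complex.exp z * z) := by
    rw [← hasSum_nat_add_iff' 1]
    simp only [Finset.range_one, Finset.sum_singleton, Nat.cast_zero, mul_zero, sub_zero]
    convert! hexp.mul_right (z : ℂ) using 2 with l
    rw [Nat.factorial_succ, pow_succ]
    push_cast
    have : (l : ℂ) + 1 ≠ 0 := Nat.cast_add_one_ne_zero l
    field_simp
  -- The weight `(z + w - l) / w` does not change the exponential series, since `∑ l z ^ l / l! = z
  -- e^z`.
  have hA : HasSum (fun l : ℕ => (z : ℂ) ^ l / l.factorial * ((z + w - l) / w))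
      (Complex.exp z) := by
    convert! ((hexp.mul_right (z + w : ℂ)).sub hexp1).div_const w using 1
    · ext l; ring
    · field_simp; ring
  have hB : Filter.Tendsto (fun n => ∑ l ∈ Finset.range n,
      (z : ℂ) ^ (1 + w + l) / Complex.Gamma (2 + w + l)) Filter.atTop
      (nhds (Complex.exp z * (Complex.partialGamma (1 + w) z / Complex.Gamma (1 + w)))) := by
    have h := ((tendsto_partialGamma_div_Gamma hw0 hz).const_sub
      (Complex.partialGamma (1 + w) z / Complex.Gamma (1 + w))).const_mul (Complex.exp z)
    rw [sub_zero] at h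
    refine h.congr fun n => ?_
    rw [partialGamma_div_Gamma hw0 hz n, add_sub_cancel_right, ← mul_assoc, ← Complex.exp_add]
    simp
  have hlim := (hA.tendsto_sum_nat.sub hB).const_mul
    (Complex.Gamma (1 - w) * Complex.Gamma (1 + w))
  -- Summability is already known from the bound, so the limit of the partial sums identifies the
  -- sum.
  refine (hs.hasSum_iff_tendsto_nat).2 ?_
  convert! hlim using 2 with n
  · rw [← Finset.sum_sub_distrib, Finset.mul_sum]
    rfl
  · field_simp

/-! ### The integrands of the two Fox `H`-functions -/

/-- The part of the Mellin–Barnes integrand that depends on one variable only. -/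
noncomputable def barnesFactor (a c x t : ℝ) : ℂ :=
  (x : ℂ) ^ (-onLine c t) * upperGammaMellin a (onLine c t)

lemma integrable_barnesFactor {a c x : ℝ} (ha : 0 < a) (hc : 0 < c) (hx : 0 < x) :
    Integrable (barnesFactor a c x) := by
  have hcont : Continuous fun t => (x : ℂ) ^ (-onLine c t) :=
    (continuous_onLine c).neg.const_cpow (Or.inl (by exact_mod_cast hx.ne'))
  refine (integrable_upperGammaMellin_onLine ha hc).bdd_mul (c := x ^ (-c))
    hcont.aestronglyMeasurable (ae_of_all _ fun t => ?_)
  rw [Complex.norm_cpow_eq_rpow_re_of_pos hx, Complex.neg_re, onLine_re]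

lemma integrable_barnesFactor_mul {a₁ a₂ c₁ c₂ x y : ℝ} (ha₁ : 0 < a₁) (ha₂ : 0 < a₂)
    (hc₁ : 0 < c₁) (hc₂ : 0 < c₂) (hx : 0 < x) (hy : 0 < y) :
    Integrable fun t : ℝ × ℝ => barnesFactor a₁ c₁ x t.1 * barnesFactor a₂ c₂ y t.2 :=
  (integrable_barnesFactor ha₁ hc₁ hx).mul_prod (integrable_barnesFactor ha₂ hc₂ hy)

/-- `Γ(s) / Γ(1 + s) = 1 / s`. -/
lemma gammaQuotient_eq_upperGammaMellin (a : ℝ) {s : ℂ} (hs : 0 < s.re) :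
    gammaQuotient [] [(1, 1)] [(0, 1), (a, 1)] [] s = upperGammaMellin a s := by
  have hne : s ≠ 0 := fun h => by rw [h] at hs; simp at hs
  have hG := Complex.Gamma_ne_zero_of_re_pos hs
  simp only [gammaQuotient, upperGammaMellin, List.map_cons, List.map_nil, List.prod_cons,
    List.prod_nil, Complex.ofReal_zero, Complex.ofReal_one, one_mul, zero_add, mul_one]
  rw [add_comm 1 s, Complex.Gamma_add_one s hne]
  field_simp

/-- Each joint parameter has equal coefficients in `s` and `v`, so the joint factor is a function of
`s + v` alone. -/
lemma foxHLineIntegrand_Lambda1 (a₁ a₂ : ℝ) {c₁ c₂ : ℝ} (hc₁ : 0 < c₁) (hc₂ : 0 < c₂) (k l : ℕ)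
    (x y : ℝ) (t : ℝ × ℝ) :
    foxHLineIntegrand c₁ c₂ (Lambda1 a₁ a₂ k l) x y t =
      (Complex.Gamma (k - 1 - l + onLine (c₁ + c₂) (t.1 + t.2)) *
        Complex.Gamma (1 + l - onLine (c₁ + c₂) (t.1 + t.2))) *
      (barnesFactor a₁ c₁ x t.1 * barnesFactor a₂ c₂ y t.2) := by
  rw [foxHLineIntegrand, foxHIntegrand, ← onLine_add]
  simp only [Lambda1]
  rw [gammaQuotient_eq_upperGammaMellin _ (by rwa [onLine_re]),
    gammaQuotient_eq_upperGammaMellin _ (by rwa [onLine_re])]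
  simp only [jointGammaQuotient, barnesFactor, List.map_cons, List.map_nil, List.prod_cons,
    List.prod_nil, mul_one, one_mul, div_one]
  push_cast
  ring_nf

lemma foxHLineIntegrand_Lambda2 (a₁ a₂ : ℝ) {c₁ c₂ : ℝ} (hc₁ : 0 < c₁) (hc₂ : 0 < c₂) (k l : ℕ)
    (x y : ℝ) (t : ℝ × ℝ) :
    foxHLineIntegrand c₁ c₂ (Lambda2 a₁ a₂ k l) x y t =
      Complex.Gamma (1 - k - l - onLine (c₁ + c₂) (t.1 + t.2)) *
      (barnesFactor a₁ c₁ x t.1 * barnesFactor a₂ c₂ y t.2) := by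
  rw [foxHLineIntegrand, foxHIntegrand, ← onLine_add]
  simp only [Lambda2]
  rw [gammaQuotient_eq_upperGammaMellin _ (by rwa [onLine_re]),
    gammaQuotient_eq_upperGammaMellin _ (by rwa [onLine_re])]
  simp only [jointGammaQuotient, barnesFactor, List.map_cons, List.map_nil, List.prod_cons,
    List.prod_nil, mul_one, one_mul, div_one]
  push_cast
  ring_nf

lemma foxH_eq_integral (c₁ c₂ : ℝ) (Λ : FoxHParams) (x y : ℝ) :
    foxH c₁ c₂ Λ x y =
      (1 / (2 * Real.pi) ^ 2 : ℂ) * ∫ t : ℝ × ℝ, foxHLineIntegrand c₁ c₂ Λ x y t := by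
  rw [foxH, integral_mul_const]
  have : (Real.pi : ℂ) ≠ 0 := by exact_mod_cast Real.pi_ne_zero
  field_simp

/-! ### Reflection formulas for the joint gamma factors -/

section Reflection

variable {w : ℂ}

lemma sub_natCast_ne_zero_of_mem_strip (hw0 : 0 < w.re) (hw1 : w.re < 1) (l : ℕ) :
    w - l ≠ 0 := fun h => by
  have h1 : w.re = l := by simpa [sub_eq_zero] using congrArg Complex.re h
  rw [h1] at hw0 hw1
  have h2 : 0 < l := by exact_mod_cast hw0
  have h3 : l < 1 := by exact_mod_cast hw1
  omega

lemma Gamma_one_add_div_self (hw0 : 0 < w.re) :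
    Complex.Gamma (1 + w) / w = Complex.Gamma w := by
  have hne : w ≠ 0 := fun h => by rw [h] at hw0; simp at hw0
  rw [add_comm, Complex.Gamma_add_one w hne]
  field_simp

/-- Reflection at `w - l` and at `w`: the two sines differ by the sign `(-1) ^ l`. -/
lemma Gamma_sub_natCast_mul (hw0 : 0 < w.re) (l : ℕ) :
    Complex.Gamma (w - l) * Complex.Gamma (1 + l - w) =
      (-1) ^ l * (Complex.Gamma (1 - w) * Complex.Gamma (1 + w) / w) := by
  have h1 := Complex.Gamma_mul_Gamma_one_sub (w - l)
  have h2 := Complex.Gamma_mul_Gamma_one_sub w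
  rw [show 1 - (w - l) = 1 + l - w by ring] at h1
  rw [mul_div_assoc, Gamma_one_add_div_self hw0, mul_comm (Complex.Gamma (1 - w)), h2, h1, mul_sub,
    mul_comm _ (l : ℂ), Complex.sin_antiperiodic.sub_nat_mul_eq]
  rcases neg_one_pow_eq_or ℂ l with h | h <;> simp [h, div_neg]

lemma Gamma_one_add_sub_natCast_mul (hw0 : 0 < w.re) (hw1 : w.re < 1) (l : ℕ) :
    Complex.Gamma (1 + w - l) * Complex.Gamma (1 + l - w) =
      (-1) ^ l * ((w - l) / w * (Complex.Gamma (1 - w) * Complex.Gamma (1 + w))) := by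
  rw [show 1 + w - l = w - l + 1 by ring,
    Complex.Gamma_add_one _ (sub_natCast_ne_zero_of_mem_strip hw0 hw1 l), mul_assoc,
    Gamma_sub_natCast_mul hw0]
  ring

/-- Reflection at `-l - w`, whose partner is `Γ(1 + w + l)`, compared with reflection at `w`. -/
lemma Gamma_neg_natCast_sub (hw0 : 0 < w.re) (l : ℕ) :
    Complex.Gamma (-l - w) =
      -(-1) ^ l * (Complex.Gamma (1 - w) * Complex.Gamma (1 + w) / w) /
        Complex.Gamma (1 + w + l) := by
  have hre : 0 < (1 + w + l).re := by simp; positivity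
  have h1 := Complex.Gamma_mul_Gamma_one_sub (-l - w)
  have h2 := Complex.Gamma_mul_Gamma_one_sub w
  rw [show 1 - (-l - w) = 1 + w + l by ring] at h1
  rw [eq_div_iff (Complex.Gamma_ne_zero_of_re_pos hre), h1, mul_div_assoc,
    Gamma_one_add_div_self hw0, mul_comm (Complex.Gamma (1 - w)), h2,
    show (Real.pi : ℂ) * (-l - w) = -(Real.pi * w + l * Real.pi) by ring, Complex.sin_neg,
    Complex.sin_antiperiodic.add_nat_mul_eq]
  rcases neg_one_pow_eq_or ℂ l with h | h <;> simp [h, div_neg]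

/-- Up to the common factor `(-1) ^ l Γ(1 - w) Γ(1 + w)`, the `Λ₁` pair contributes `z / w + (w - l)
/ w`, and the `Λ₂` pair contributes `(-(1 + w + l) + (1 + l)) / (w Γ(2 + w + l)) = -1 / Γ(2 + w +
l)`. -/
lemma sinrMellinTerm_eq {z : ℝ} (hz : 0 < z) (hw0 : 0 < w.re) (hw1 : w.re < 1) (l : ℕ) :
    sinrMellinTerm z l w = (-z : ℂ) ^ l *
      (1 / l.factorial * (z * (Complex.Gamma (w - l) * Complex.Gamma (1 + l - w)) +
          Complex.Gamma (1 + w - l) * Complex.Gamma (1 + l - w)) +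
        z * (z : ℂ) ^ w * (Complex.Gamma (-l - w) +
          (1 + l) * Complex.Gamma (-(l + 1 : ℕ) - w))) := by
  have hwne : w ≠ 0 := fun h => by rw [h] at hw0; simp at hw0
  have hz' : (z : ℂ) ≠ 0 := by exact_mod_cast hz.ne'
  have hre : 0 < (1 + w + l).re := by simp; positivity
  have hne : (1 + w + l : ℂ) ≠ 0 := fun h => by rw [h] at hre; simp at hre
  have hG := Complex.Gamma_ne_zero_of_re_pos hre
  have hpow : (z : ℂ) ^ (1 + w + l) = z * (z : ℂ) ^ w * (z : ℂ) ^ l := by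
    rw [Complex.cpow_add _ _ hz', Complex.cpow_add _ _ hz', Complex.cpow_one, Complex.cpow_natCast]
  have hfac : (l.factorial : ℂ) ≠ 0 := by exact_mod_cast l.factorial_ne_zero
  rw [Gamma_sub_natCast_mul hw0, Gamma_one_add_sub_natCast_mul hw0 hw1, Gamma_neg_natCast_sub hw0,
    Gamma_neg_natCast_sub hw0, sinrMellinTerm, hpow, show (2 + w + l : ℂ) = 1 + w + l + 1 by ring,
    show (1 + w + (l + 1 : ℕ) : ℂ) = 1 + w + l + 1 by push_cast; ring,
    Complex.Gamma_add_one _ hne, neg_pow, pow_succ]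
  rcases neg_one_pow_eq_or ℂ l with h | h <;> rw [h] <;> field_simp <;> ring

end Reflection

/-! ### Absolute convergence of the double Mellin–Barnes integrals -/

/-- The poles of `Γ` are integers, and `n + c` is never one when `0 < c < 1`. -/
lemma continuous_Gamma_intCast_add_onLine {c : ℝ} (hc0 : 0 < c) (hc1 : c < 1) (n : ℤ) :
    Continuous fun τ => Complex.Gamma (n + onLine c τ) := by
  refine continuous_iff_continuousAt.2 fun τ => ContinuousAt.comp (g := Complex.Gamma)
    (f := fun τ => (n : ℂ) + onLine c τ) ?_ (continuous_const.add (continuous_onLine c)).continuousAt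
  refine (Complex.differentiableAt_Gamma _ fun m h => ?_).continuousAt
  have h1 : (n : ℝ) + c = -m := by simpa [onLine_re] using congrArg Complex.re h
  have h2 : ((-m - n : ℤ) : ℝ) = c := by push_cast; linarith
  rw [← h2] at hc0 hc1
  have h3 : 0 < -(m : ℤ) - n := by exact_mod_cast hc0
  have h4 : -(m : ℤ) - n < 1 := by exact_mod_cast hc1
  omega

lemma continuous_Gamma_intCast_sub_onLine {c : ℝ} (hc0 : 0 < c) (hc1 : c < 1) (n : ℤ) :
    Continuous fun τ => Complex.Gamma (n - onLine c τ) := by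
  -- `n - (c + iτ) = (n - 1) + ((1 - c) + i(-τ))`.
  have h := (continuous_Gamma_intCast_add_onLine (c := 1 - c) (by linarith) (by linarith)
    (n - 1)).comp continuous_neg
  refine h.congr fun τ => ?_
  simp only [Function.comp]
  congr 1
  simp [onLine]
  ring

section Bounds

variable {w : ℂ}

lemma norm_Gamma_one_sub_mul_le (hw0 : 0 < w.re) (hw1 : w.re < 1) :
    ‖Complex.Gamma (1 - w) * Complex.Gamma (1 + w)‖ ≤
      Real.Gamma (1 - w.re) * Real.Gamma (1 + w.re) := by
  have h1 := norm_Gamma_le_Gamma_re (s := 1 - w) (by simp; linarith)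
  have h2 := norm_Gamma_le_Gamma_re (s := 1 + w) (by simp; linarith)
  simp only [Complex.sub_re, Complex.add_re, Complex.one_re] at h1 h2
  rw [norm_mul]
  exact mul_le_mul h1 h2 (norm_nonneg _) ((norm_nonneg _).trans h1)

lemma norm_Gamma_sub_natCast_mul_le (hw0 : 0 < w.re) (hw1 : w.re < 1) (l : ℕ) :
    ‖Complex.Gamma (w - l) * Complex.Gamma (1 + l - w)‖ ≤
      Real.Gamma (1 - w.re) * Real.Gamma (1 + w.re) / w.re := by
  rw [Gamma_sub_natCast_mul hw0, norm_mul, norm_pow, norm_neg, norm_one, one_pow, one_mul, norm_div]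
  exact div_le_div₀ ((norm_nonneg _).trans (norm_Gamma_one_sub_mul_le hw0 hw1))
    (norm_Gamma_one_sub_mul_le hw0 hw1) hw0 (Complex.re_le_norm w)

lemma norm_Gamma_one_add_sub_natCast_mul_le (hw0 : 0 < w.re) (hw1 : w.re < 1) (l : ℕ) :
    ‖Complex.Gamma (1 + w - l) * Complex.Gamma (1 + l - w)‖ ≤
      (1 + l / w.re) * (Real.Gamma (1 - w.re) * Real.Gamma (1 + w.re)) := by
  have hwne : w ≠ 0 := fun h => by rw [h] at hw0; simp at hw0
  rw [Gamma_one_add_sub_natCast_mul hw0 hw1, norm_mul, norm_pow, norm_neg, norm_one, one_pow,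
    one_mul, norm_mul]
  refine mul_le_mul ?_ (norm_Gamma_one_sub_mul_le hw0 hw1) (norm_nonneg _) (by positivity)
  rw [sub_div, div_self hwne]
  refine (norm_sub_le _ _).trans ?_
  rw [norm_one, norm_div, Complex.norm_natCast]
  gcongr
  exact Complex.re_le_norm w

lemma norm_Gamma_neg_natCast_sub_le (hw0 : 0 < w.re) (hw1 : w.re < 1) (l : ℕ) :
    ‖Complex.Gamma (-l - w)‖ ≤ Real.Gamma (1 - w.re) / w.re := by
  have h1 := norm_Gamma_le_Gamma_re (s := 1 - w) (by simp; linarith)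
  simp only [Complex.sub_re, Complex.one_re] at h1
  have hG : 0 < ‖Complex.Gamma (1 + w)‖ :=
    norm_pos_iff.2 (Complex.Gamma_ne_zero_of_re_pos (by simp; linarith))
  have h2 : ‖Complex.Gamma (1 + w)‖ ≤ ‖Complex.Gamma (1 + w + l)‖ := by
    refine le_trans ?_ (factorial_mul_norm_Gamma_le hw0 l)
    have : (1 : ℝ) ≤ l.factorial := by exact_mod_cast l.factorial_pos
    nlinarith
  rw [Gamma_neg_natCast_sub hw0]
  have h3 : ‖-(-1) ^ l * (Complex.Gamma (1 - w) * Complex.Gamma (1 + w) / w) /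
      Complex.Gamma (1 + w + l)‖ = ‖Complex.Gamma (1 - w)‖ / ‖w‖ *
        (‖Complex.Gamma (1 + w)‖ / ‖Complex.Gamma (1 + w + l)‖) := by
    simp only [norm_div, norm_mul, norm_neg, norm_pow, norm_one, one_pow, one_mul]
    ring
  rw [h3]
  calc _ ≤ ‖Complex.Gamma (1 - w)‖ / ‖w‖ * 1 := by
        gcongr
        exact div_le_one_of_le₀ h2 (norm_nonneg _)
    _ ≤ _ := by
        rw [mul_one]
        exact div_le_div₀ ((norm_nonneg _).trans h1) h1 hw0 (Complex.re_le_norm w)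

end Bounds

/-- The one-variable factors are integrable by themselves, so the joint factor need only be bounded
and continuous. -/
lemma integrable_mul_barnesFactor {a₁ a₂ c₁ c₂ x y : ℝ} (ha₁ : 0 < a₁) (ha₂ : 0 < a₂)
    (hc₁ : 0 < c₁) (hc₂ : 0 < c₂) (hx : 0 < x) (hy : 0 < y) {Φ : ℝ → ℂ} {C : ℝ}
    (hΦ : Continuous Φ) (hC : ∀ τ, ‖Φ τ‖ ≤ C) :
    Integrable fun t : ℝ × ℝ =>
      Φ (t.1 + t.2) * (barnesFactor a₁ c₁ x t.1 * barnesFactor a₂ c₂ y t.2) :=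
  (integrable_barnesFactor_mul ha₁ ha₂ hc₁ hc₂ hx hy).bdd_mul (c := C)
    (hΦ.comp (continuous_fst.add continuous_snd)).aestronglyMeasurable
    (ae_of_all _ fun _ => hC _)

lemma integrable_foxHLineIntegrand_Lambda1 {a₁ a₂ c₁ c₂ x y : ℝ} (ha₁ : 0 < a₁)
    (ha₂ : 0 < a₂) (hc₁ : 0 < c₁) (hc₂ : 0 < c₂) (hc : c₁ + c₂ < 1) (hx : 0 < x) (hy : 0 < y)
    {k : ℕ} (hk : k ∈ Finset.Icc 1 2) (l : ℕ) :
    Integrable (foxHLineIntegrand c₁ c₂ (Lambda1 a₁ a₂ k l) x y) := by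
  have hc0 : 0 < c₁ + c₂ := by positivity
  simp_rw [funext (foxHLineIntegrand_Lambda1 a₁ a₂ hc₁ hc₂ k l x y)]
  have hcont : Continuous fun τ => Complex.Gamma (k - 1 - l + onLine (c₁ + c₂) τ) *
      Complex.Gamma (1 + l - onLine (c₁ + c₂) τ) := by
    have h1 := continuous_Gamma_intCast_add_onLine hc0 hc (k - 1 - l)
    have h2 := continuous_Gamma_intCast_sub_onLine hc0 hc (1 + l)
    push_cast at h1 h2
    exact h1.mul h2
  have hbd : ∃ C, ∀ τ, ‖Complex.Gamma (k - 1 - l + onLine (c₁ + c₂) τ) *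
      Complex.Gamma (1 + l - onLine (c₁ + c₂) τ)‖ ≤ C := by
    obtain rfl | rfl : k = 1 ∨ k = 2 := by
      rw [Finset.mem_Icc] at hk; omega
    · refine ⟨Real.Gamma (1 - (c₁ + c₂)) * Real.Gamma (1 + (c₁ + c₂)) / (c₁ + c₂), fun τ => ?_⟩
      have h := norm_Gamma_sub_natCast_mul_le (w := onLine (c₁ + c₂) τ) (by rwa [onLine_re])
        (by rwa [onLine_re]) l
      rw [onLine_re] at h
      convert! h using 4
      push_cast; ring
    · refine ⟨(1 + l / (c₁ + c₂)) *
        (Real.Gamma (1 - (c₁ + c₂)) * Real.Gamma (1 + (c₁ + c₂))), fun τ => ?_⟩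
      have h := norm_Gamma_one_add_sub_natCast_mul_le (w := onLine (c₁ + c₂) τ)
        (by rwa [onLine_re]) (by rwa [onLine_re]) l
      rw [onLine_re] at h
      convert! h using 4
      push_cast; ring
  obtain ⟨C, hC⟩ := hbd
  exact integrable_mul_barnesFactor ha₁ ha₂ hc₁ hc₂ hx hy hcont hC

lemma integrable_foxHLineIntegrand_Lambda2 {a₁ a₂ c₁ c₂ x y : ℝ} (ha₁ : 0 < a₁)
    (ha₂ : 0 < a₂) (hc₁ : 0 < c₁) (hc₂ : 0 < c₂) (hc : c₁ + c₂ < 1) (hx : 0 < x) (hy : 0 < y)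
    {k : ℕ} (hk : 1 ≤ k) (l : ℕ) :
    Integrable (foxHLineIntegrand c₁ c₂ (Lambda2 a₁ a₂ k l) x y) := by
  have hc0 : 0 < c₁ + c₂ := by positivity
  simp_rw [funext (foxHLineIntegrand_Lambda2 a₁ a₂ hc₁ hc₂ k l x y)]
  have hcont : Continuous fun τ => Complex.Gamma (1 - k - l - onLine (c₁ + c₂) τ) := by
    have h2 := continuous_Gamma_intCast_sub_onLine hc0 hc (1 - k - l)
    push_cast at h2
    exact h2
  refine integrable_mul_barnesFactor ha₁ ha₂ hc₁ hc₂ hx hy hcont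
    (C := Real.Gamma (1 - (c₁ + c₂)) / (c₁ + c₂)) fun τ => ?_
  -- The natural number shift is `k - 1 + l`; the truncated subtraction is exact because `1 ≤ k`.
  have h := norm_Gamma_neg_natCast_sub_le (w := onLine (c₁ + c₂) τ) (by rwa [onLine_re])
    (by rwa [onLine_re]) (k - 1 + l)
  rw [onLine_re] at h
  convert! h using 3
  push_cast [hk]
  ring

/-! ### The series of Fox `H`-functions -/

lemma barnesFactor_mul (a c t : ℝ) {x u : ℝ} (hx : 0 < x) (hu : 0 < u) :
    barnesFactor a c (x * u) t = (u : ℂ) ^ (-onLine c t) * barnesFactor a c x t := by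
  rw [barnesFactor, barnesFactor, Complex.ofReal_mul,
    Complex.mul_cpow_ofReal_nonneg hx.le hu.le]
  ring

lemma barnesFactor_mul_barnesFactor (a₁ a₂ c₁ c₂ : ℝ) (t : ℝ × ℝ) {x y u : ℝ} (hx : 0 < x)
    (hy : 0 < y) (hu : 0 < u) :
    barnesFactor a₁ c₁ (x * u) t.1 * barnesFactor a₂ c₂ (y * u) t.2 =
      (u : ℂ) ^ (-onLine (c₁ + c₂) (t.1 + t.2)) *
        (barnesFactor a₁ c₁ x t.1 * barnesFactor a₂ c₂ y t.2) := by
  rw [barnesFactor_mul _ _ _ hx hu, barnesFactor_mul _ _ _ hy hu, ← onLine_add, neg_add,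
    Complex.cpow_add _ _ (by exact_mod_cast hu.ne')]
  ring

lemma continuous_barnesFactor {a c x : ℝ} (ha : 0 < a) (hc : 0 < c) (hx : 0 < x) :
    Continuous (barnesFactor a c x) :=
  ((continuous_onLine c).neg.const_cpow (Or.inl (by exact_mod_cast hx.ne'))).mul
    (continuous_upperGammaMellin_onLine ha hc)

lemma measurable_sinrKernel (z : ℝ) : Measurable (sinrKernel z) := by
  unfold sinrKernel; fun_prop

/-- Fubini after inserting both Mellin–Barnes integrals. As `|u ^ (-w)| = u ^ (-(c₁ + c₂))` does not
depend on the heights, the norm splits into a function of `u` times a function of `t`. -/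
theorem integral_sinrKernel_mul_upperGamma {a₁ a₂ c₁ c₂ x y z : ℝ} (ha₁ : 0 < a₁) (ha₂ : 0 < a₂)
    (hc₁ : 0 < c₁) (hc₂ : 0 < c₂) (hc : c₁ + c₂ < 1) (hx : 0 < x) (hy : 0 < y) (hz : 0 < z) :
    ∫ u in Set.Ioi (0 : ℝ), (sinrKernel z u : ℂ) *
        ((upperGamma a₁ (x * u) : ℂ) * (upperGamma a₂ (y * u) : ℂ)) =
      (1 / (2 * Real.pi) ^ 2 : ℂ) * ∫ t : ℝ × ℝ,
        mellin (fun u => (sinrKernel z u : ℂ)) (1 - onLine (c₁ + c₂) (t.1 + t.2)) *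
          (barnesFactor a₁ c₁ x t.1 * barnesFactor a₂ c₂ y t.2) := by
  have hc0 : 0 < c₁ + c₂ := by positivity
  have hK := integrable_barnesFactor_mul ha₁ ha₂ hc₁ hc₂ hx hy
  have hprod : ∀ u ∈ Set.Ioi (0 : ℝ), (sinrKernel z u : ℂ) *
        ((upperGamma a₁ (x * u) : ℂ) * (upperGamma a₂ (y * u) : ℂ)) =
      (1 / (2 * Real.pi) ^ 2 : ℂ) * ∫ t : ℝ × ℝ, (sinrKernel z u : ℂ) *
        (u : ℂ) ^ (-onLine (c₁ + c₂) (t.1 + t.2)) *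
          (barnesFactor a₁ c₁ x t.1 * barnesFactor a₂ c₂ y t.2) := by
    intro u (hu : 0 < u)
    rw [upperGamma_eq_integral_onLine ha₁ hc₁ (mul_pos hx hu),
      upperGamma_eq_integral_onLine ha₂ hc₂ (mul_pos hy hu)]
    have h1 : ∀ t : ℝ × ℝ, (sinrKernel z u : ℂ) * (u : ℂ) ^ (-onLine (c₁ + c₂) (t.1 + t.2)) *
          (barnesFactor a₁ c₁ x t.1 * barnesFactor a₂ c₂ y t.2) = (sinrKernel z u : ℂ) *
          (barnesFactor a₁ c₁ (x * u) t.1 * barnesFactor a₂ c₂ (y * u) t.2) := fun t => by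
      rw [barnesFactor_mul_barnesFactor _ _ _ _ _ hx hy hu]; ring
    simp_rw [h1]
    rw [integral_const_mul, Measure.volume_eq_prod, integral_prod_mul]
    simp only [barnesFactor]
    ring
  have hnorm : IntegrableOn (fun u : ℝ => ‖(sinrKernel z u : ℂ)‖ * u ^ (-(c₁ + c₂))) (Set.Ioi 0) := by
    -- Mellin convergence at the real point `1 - (c₁ + c₂)` is the needed integrability in `u`.
    have h := (hasMellin_sinrKernel hz (w := (c₁ + c₂ : ℝ)) (by simpa using hc0)
      (by simpa using hc)).1.norm
    refine IntegrableOn.congr_fun h (fun u hu => ?_) measurableSet_Ioi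
    simp only [smul_eq_mul]
    rw [norm_mul, Complex.norm_cpow_eq_rpow_re_of_pos hu, mul_comm]
    simp
  have hF : Integrable (fun p : ℝ × (ℝ × ℝ) => (sinrKernel z p.1 : ℂ) *
      (p.1 : ℂ) ^ (-onLine (c₁ + c₂) (p.2.1 + p.2.2)) *
        (barnesFactor a₁ c₁ x p.2.1 * barnesFactor a₂ c₂ y p.2.2))
      ((volume.restrict (Set.Ioi 0)).prod volume) := by
    refine Integrable.mono' (hnorm.mul_prod hK.norm) ?_ ?_
    · have h1 := measurable_sinrKernel z
      have h2 := (continuous_barnesFactor ha₁ hc₁ hx).measurable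
      have h3 := (continuous_barnesFactor ha₂ hc₂ hy).measurable
      have h4 := (continuous_onLine (c₁ + c₂)).measurable
      exact Measurable.aestronglyMeasurable (by fun_prop)
    · have : ∀ᵐ p : ℝ × (ℝ × ℝ) ∂((volume.restrict (Set.Ioi 0)).prod volume), 0 < p.1 :=
        Measure.quasiMeasurePreserving_fst.ae (ae_restrict_mem measurableSet_Ioi)
      filter_upwards [this] with p hp
      rw [norm_mul, norm_mul, Complex.norm_cpow_eq_rpow_re_of_pos hp, Complex.neg_re, onLine_re]
  rw [setIntegral_congr_fun measurableSet_Ioi hprod, integral_const_mul,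
    integral_integral_swap hF]
  congr 1
  refine integral_congr_ae (ae_of_all _ fun t => ?_)
  simp only [mellin]
  rw [integral_mul_const]
  congr 1
  refine setIntegral_congr_fun measurableSet_Ioi fun u _ => ?_
  rw [smul_eq_mul, mul_comm, show 1 - onLine (c₁ + c₂) (t.1 + t.2) - 1 =
    -onLine (c₁ + c₂) (t.1 + t.2) by ring]

/-- The integrand, on the product of the two contours, of the `l`-th term of the series. -/
noncomputable def barnesTerm (a₁ a₂ c₁ c₂ x y z : ℝ) (l : ℕ) (t : ℝ × ℝ) : ℂ :=
  sinrMellinTerm z l (onLine (c₁ + c₂) (t.1 + t.2)) *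
    (barnesFactor a₁ c₁ x t.1 * barnesFactor a₂ c₂ y t.2)

/-- The factor `z ^ w` of the `Λ₂` part is absorbed by scaling both arguments by `z⁻¹`, which is why
the two arrays are evaluated at different points. -/
lemma barnesTerm_eq {a₁ a₂ c₁ c₂ x y z : ℝ} (hc₁ : 0 < c₁) (hc₂ : 0 < c₂) (hc : c₁ + c₂ < 1)
    (hx : 0 < x) (hy : 0 < y) (hz : 0 < z) (l : ℕ) (t : ℝ × ℝ) :
    barnesTerm a₁ a₂ c₁ c₂ x y z l t = (-z : ℂ) ^ l *
      (1 / l.factorial * z * foxHLineIntegrand c₁ c₂ (Lambda1 a₁ a₂ 1 l) x y t +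
        1 / l.factorial * foxHLineIntegrand c₁ c₂ (Lambda1 a₁ a₂ 2 l) x y t +
        z * foxHLineIntegrand c₁ c₂ (Lambda2 a₁ a₂ 1 l) (x * z⁻¹) (y * z⁻¹) t +
        z * (1 + l) * foxHLineIntegrand c₁ c₂ (Lambda2 a₁ a₂ 2 l) (x * z⁻¹) (y * z⁻¹) t) := by
  have hc0 : 0 < c₁ + c₂ := by positivity
  have hz' : (z : ℂ) ≠ 0 := by exact_mod_cast hz.ne'
  rw [foxHLineIntegrand_Lambda1 _ _ hc₁ hc₂, foxHLineIntegrand_Lambda1 _ _ hc₁ hc₂,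
    foxHLineIntegrand_Lambda2 _ _ hc₁ hc₂, foxHLineIntegrand_Lambda2 _ _ hc₁ hc₂,
    barnesFactor_mul_barnesFactor _ _ _ _ _ hx hy (inv_pos.2 hz), barnesTerm,
    sinrMellinTerm_eq hz (by rwa [onLine_re]) (by rwa [onLine_re])]
  set w := onLine (c₁ + c₂) (t.1 + t.2)
  have h1 : ((z⁻¹ : ℝ) : ℂ) ^ (-w) = (z : ℂ) ^ w := by
    rw [Complex.ofReal_inv, Complex.inv_cpow _ _
      (by rw [Complex.arg_ofReal_of_nonneg hz.le]; exact Real.pi_pos.ne), Complex.cpow_neg, inv_inv]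
  rw [h1, show ((1 : ℕ) - 1 - l + w : ℂ) = w - l by push_cast; ring,
    show ((2 : ℕ) - 1 - l + w : ℂ) = 1 + w - l by push_cast; ring,
    show (1 - (1 : ℕ) - l - w : ℂ) = -l - w by push_cast; ring,
    show (1 - (2 : ℕ) - l - w : ℂ) = -(l + 1 : ℕ) - w by push_cast; ring]
  ring

section Series

variable {a₁ a₂ c₁ c₂ x y z : ℝ}

lemma integrable_barnesTerm (ha₁ : 0 < a₁) (ha₂ : 0 < a₂) (hc₁ : 0 < c₁) (hc₂ : 0 < c₂)
    (hc : c₁ + c₂ < 1) (hx : 0 < x) (hy : 0 < y) (hz : 0 < z) (l : ℕ) :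
    Integrable (barnesTerm a₁ a₂ c₁ c₂ x y z l) := by
  have hz' : 0 < z⁻¹ := inv_pos.2 hz
  simp_rw [funext (barnesTerm_eq hc₁ hc₂ hc hx hy hz l)]
  refine Integrable.const_mul (((Integrable.add (Integrable.const_mul ?_ _)
    (Integrable.const_mul ?_ _)).add (Integrable.const_mul ?_ _)).add (Integrable.const_mul ?_ _)) _
  · exact integrable_foxHLineIntegrand_Lambda1 ha₁ ha₂ hc₁ hc₂ hc hx hy (by simp) l
  · exact integrable_foxHLineIntegrand_Lambda1 ha₁ ha₂ hc₁ hc₂ hc hx hy (by simp) l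
  · exact integrable_foxHLineIntegrand_Lambda2 ha₁ ha₂ hc₁ hc₂ hc (mul_pos hx hz')
      (mul_pos hy hz') (by simp) l
  · exact integrable_foxHLineIntegrand_Lambda2 ha₁ ha₂ hc₁ hc₂ hc (mul_pos hx hz')
      (mul_pos hy hz') (by simp) l

lemma integral_barnesTerm (ha₁ : 0 < a₁) (ha₂ : 0 < a₂) (hc₁ : 0 < c₁) (hc₂ : 0 < c₂)
    (hc : c₁ + c₂ < 1) (hx : 0 < x) (hy : 0 < y) (hz : 0 < z) (l : ℕ) :
    (1 / (2 * Real.pi) ^ 2 : ℂ) * ∫ t, barnesTerm a₁ a₂ c₁ c₂ x y z l t = (-z : ℂ) ^ l *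
      (1 / l.factorial * z * foxH c₁ c₂ (Lambda1 a₁ a₂ 1 l) x y +
        1 / l.factorial * foxH c₁ c₂ (Lambda1 a₁ a₂ 2 l) x y +
        z * foxH c₁ c₂ (Lambda2 a₁ a₂ 1 l) (x * z⁻¹) (y * z⁻¹) +
        z * (1 + l) * foxH c₁ c₂ (Lambda2 a₁ a₂ 2 l) (x * z⁻¹) (y * z⁻¹)) := by
  have hz' : 0 < z⁻¹ := inv_pos.2 hz
  have h1 := integrable_foxHLineIntegrand_Lambda1 ha₁ ha₂ hc₁ hc₂ hc hx hy (k := 1) (by simp) l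
  have h2 := integrable_foxHLineIntegrand_Lambda1 ha₁ ha₂ hc₁ hc₂ hc hx hy (k := 2) (by simp) l
  have h3 := integrable_foxHLineIntegrand_Lambda2 ha₁ ha₂ hc₁ hc₂ hc (mul_pos hx hz')
      (mul_pos hy hz') (k := 1) (by simp) l
  have h4 := integrable_foxHLineIntegrand_Lambda2 ha₁ ha₂ hc₁ hc₂ hc (mul_pos hx hz')
      (mul_pos hy hz') (k := 2) (by simp) l
  simp_rw [barnesTerm_eq hc₁ hc₂ hc hx hy hz l, foxH_eq_integral]
  rw [integral_const_mul, integral_add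
      (by exact ((h1.const_mul _).add (h2.const_mul _)).add (h3.const_mul _)) (h4.const_mul _),
    integral_add (by exact (h1.const_mul _).add (h2.const_mul _)) (h3.const_mul _),
    integral_add (h1.const_mul _) (h2.const_mul _), integral_const_mul, integral_const_mul,
    integral_const_mul, integral_const_mul]
  ring

theorem hasSum_integral_barnesTerm (ha₁ : 0 < a₁) (ha₂ : 0 < a₂) (hc₁ : 0 < c₁) (hc₂ : 0 < c₂)
    (hc : c₁ + c₂ < 1) (hx : 0 < x) (hy : 0 < y) (hz : 0 < z) :
    HasSum (fun l => (1 / (2 * Real.pi) ^ 2 : ℂ) * ∫ t, barnesTerm a₁ a₂ c₁ c₂ x y z l t)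
      (∫ u in Set.Ioi (0 : ℝ), (sinrKernel z u : ℂ) *
        ((upperGamma a₁ (x * u) : ℂ) * (upperGamma a₂ (y * u) : ℂ))) := by
  have hc0 : 0 < c₁ + c₂ := by positivity
  rw [integral_sinrKernel_mul_upperGamma ha₁ ha₂ hc₁ hc₂ hc hx hy hz]
  refine HasSum.mul_left _ ?_
  have hsum : ∀ t : ℝ × ℝ, ∑' l, barnesTerm a₁ a₂ c₁ c₂ x y z l t =
      mellin (fun u => (sinrKernel z u : ℂ)) (1 - onLine (c₁ + c₂) (t.1 + t.2)) *
          (barnesFactor a₁ c₁ x t.1 * barnesFactor a₂ c₂ y t.2) := fun t => by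
    have hw0 : 0 < (onLine (c₁ + c₂) (t.1 + t.2)).re := by rwa [onLine_re]
    have hw1 : (onLine (c₁ + c₂) (t.1 + t.2)).re < 1 := by rwa [onLine_re]
    rw [(hasMellin_sinrKernel hz hw0 hw1).2]
    exact ((hasSum_sinrMellinTerm hz hw0 hw1).mul_right _).tsum_eq
  simp_rw [← hsum]
  refine hasSum_integral_of_summable_integral_norm
    (integrable_barnesTerm ha₁ ha₂ hc₁ hc₂ hc hx hy hz) ?_
  have hK := integrable_barnesFactor_mul ha₁ ha₂ hc₁ hc₂ hx hy
  refine Summable.of_nonneg_of_le (fun l => integral_nonneg fun t => norm_nonneg _) (fun l => ?_)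
    ((summable_sinrMellinBound hz (c₁ + c₂)).mul_right
      (∫ t : ℝ × ℝ, ‖barnesFactor a₁ c₁ x t.1 * barnesFactor a₂ c₂ y t.2‖))
  rw [← integral_const_mul]
  refine integral_mono (integrable_barnesTerm ha₁ ha₂ hc₁ hc₂ hc hx hy hz l).norm
    (hK.norm.const_mul _) fun t => ?_
  have h := norm_sinrMellinTerm_le hz (w := onLine (c₁ + c₂) (t.1 + t.2)) (by rwa [onLine_re])
    (by rwa [onLine_re]) l
  rw [onLine_re] at h
  simp only [barnesTerm]
  rw [norm_mul]
  exact mul_le_mul_of_nonneg_right h (norm_nonneg _)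

end Series

/-! ### The intercept probability in the Gamma / Exponential model -/

lemma gammaMeasure_Ici {a r x : ℝ} (ha : 0 < a) (hr : 0 < r) (hx : 0 ≤ x) :
    gammaMeasure a r (Set.Ici x) = ENNReal.ofReal (upperGamma a (r * x) / Real.Gamma a) := by
  have hG := Real.Gamma_pos_of_pos ha
  have hint : IntegrableOn (fun t : ℝ => r ^ a / Real.Gamma a * t ^ (a - 1) * Real.exp (-(r * t)))
      (Set.Ioi x) := by
    have h1 : IntegrableOn (fun u : ℝ => u ^ (a - 1) * Real.exp (-(r * u))) (Set.Ioi 0) := by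
      simpa using integrableOn_rpow_mul_exp_neg_mul_rpow (p := 1) (s := a - 1) (b := r)
        (by linarith) one_pos hr
    have h2 := (h1.mono_set (Set.Ioi_subset_Ioi hx)).const_mul (r ^ a / Real.Gamma a)
    simp only [mul_assoc]
    exact h2
  rw [gammaMeasure, withDensity_apply _ measurableSet_Ici, setLIntegral_congr Ioi_ae_eq_Ici.symm,
    setLIntegral_congr_fun measurableSet_Ioi fun t (ht : x < t) =>
      gammaPDF_of_nonneg (hx.trans ht.le),
    ← ofReal_integral_eq_lintegral_ofReal hint]
  · congr 1
    have h1 := integral_comp_mul_left_Ioi (fun t : ℝ => t ^ (a - 1) * Real.exp (-t)) x hr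
    rw [smul_eq_mul, ← upperGamma, eq_inv_mul_iff_mul_eq₀ hr.ne'] at h1
    rw [← h1, ← integral_const_mul, ← integral_div]
    refine setIntegral_congr_fun measurableSet_Ioi fun t (ht : x < t) => ?_
    rw [Real.mul_rpow hr.le (hx.trans ht.le), Real.rpow_sub_one hr.ne']
    field_simp
  · filter_upwards [ae_restrict_mem measurableSet_Ioi] with t ht
    have : 0 < t := hx.trans_lt ht
    simp only [Pi.zero_apply]
    positivity

lemma ae_nonneg_gammaMeasure (a r : ℝ) : ∀ᵐ x ∂(gammaMeasure a r), 0 ≤ x := by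
  rw [ae_iff]
  simp only [not_le]
  change gammaMeasure a r (Set.Iio 0) = 0
  rw [gammaMeasure, withDensity_apply _ measurableSet_Iio, lintegral_gammaPDF_of_nonpos le_rfl]

lemma lintegral_expMeasure {r : ℝ} {g : ℝ → ENNReal} (hg : Measurable g) :
    ∫⁻ x, g x ∂(expMeasure r) =
      ∫⁻ x in Set.Ioi 0, ENNReal.ofReal (r * Real.exp (-(r * x))) * g x := by
  have hm : Measurable (exponentialPDF r) := (measurable_exponentialPDFReal r).ennreal_ofReal
  have h : expMeasure r = volume.withDensity (exponentialPDF r) := rfl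
  rw [h, lintegral_withDensity_eq_lintegral_mul _ hm hg,
    ← lintegral_add_compl _ (measurableSet_Ici (a := (0 : ℝ))),
    setLIntegral_congr Ioi_ae_eq_Ici.symm,
    setLIntegral_congr_fun (s := (Set.Ici (0 : ℝ))ᶜ) (g := fun _ => 0) measurableSet_Ici.compl,
    lintegral_zero, add_zero]
  · refine setLIntegral_congr_fun measurableSet_Ioi fun x (hx : 0 < x) => ?_
    rw [Pi.mul_apply, exponentialPDF_of_nonneg hx.le]
  · intro x hx
    rw [Pi.mul_apply, exponentialPDF_of_neg (by simpa using hx), zero_mul]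

lemma lintegral_Ioi_comp_mul_left {b : ℝ} (hb : 0 < b) (g : ℝ → ENNReal) :
    ∫⁻ x in Set.Ioi 0, g x = ∫⁻ x in Set.Ioi 0, ENNReal.ofReal b * g (b * x) := by
  have h := lintegral_image_eq_lintegral_abs_deriv_mul (s := Set.Ioi (0 : ℝ)) (f := (b * ·))
    (f' := fun _ => b) measurableSet_Ioi
    (fun x _ => by simpa using ((hasDerivAt_id x).const_mul b).hasDerivWithinAt)
    (mul_right_injective₀ hb.ne').injOn g
  rwa [Set.image_mul_left_Ioi hb, mul_zero, abs_of_pos hb] at h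

lemma integrableOn_and_integral_add_one_mul_exp {b : ℝ} (hb : 0 < b) :
    IntegrableOn (fun y : ℝ => (y + 1) * Real.exp (-(b * y))) (Set.Ioi 0) ∧
      ∫ y in Set.Ioi (0 : ℝ), (y + 1) * Real.exp (-(b * y)) = 1 / b + 1 / b ^ 2 := by
  have h1 : IntegrableOn (fun y : ℝ => y * Real.exp (-(b * y))) (Set.Ioi 0) := by
    simpa using integrableOn_rpow_mul_exp_neg_mul_rpow (p := 1) (s := 1) (b := b)
      (by norm_num) one_pos hb
  have h0 : IntegrableOn (fun y : ℝ => Real.exp (-(b * y))) (Set.Ioi 0) := by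
    simpa using integrableOn_rpow_mul_exp_neg_mul_rpow (p := 1) (s := 0) (b := b)
      (by norm_num) one_pos hb
  have e1 : ∫ y in Set.Ioi (0 : ℝ), y * Real.exp (-(b * y)) = 1 / b ^ 2 := by
    have h := Real.integral_rpow_mul_exp_neg_mul_Ioi (a := 2) two_pos hb
    rw [Real.Gamma_two, mul_one, Real.rpow_two] at h
    norm_num at h ⊢
    exact h
  have e0 : ∫ y in Set.Ioi (0 : ℝ), Real.exp (-(b * y)) = 1 / b := by
    have h := Real.integral_rpow_mul_exp_neg_mul_Ioi (a := 1) one_pos hb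
    rw [Real.Gamma_one, mul_one, Real.rpow_one] at h
    norm_num at h ⊢
    exact h
  simp_rw [add_mul, one_mul]
  refine ⟨Integrable.add h1 h0, ?_⟩
  rw [integral_add h1 h0, e1, e0, add_comm]

/-- The density of `X / (Y + 1)` for independent exponential variables with rates `r₁`, `r₂`. -/
lemma lintegral_exp_div_exp_add_one {r₁ r₂ : ℝ} (hr₁ : 0 < r₁) (hr₂ : 0 < r₂) {h : ℝ → ENNReal}
    (hh : Measurable h) :
    ∫⁻ p, h (p.1 / (p.2 + 1)) ∂((expMeasure r₁).prod (expMeasure r₂)) =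
      ∫⁻ x in Set.Ioi 0, ENNReal.ofReal (r₁ * r₂ * Real.exp (-(r₁ * x)) *
        (1 / (r₁ * x + r₂) + 1 / (r₁ * x + r₂) ^ 2)) * h x := by
  have := isProbabilityMeasure_expMeasure hr₁
  have := isProbabilityMeasure_expMeasure hr₂
  rw [lintegral_prod_symm' _ (by fun_prop), lintegral_expMeasure
    (Measurable.lintegral_prod_left' (f := fun p : ℝ × ℝ => h (p.1 / (p.2 + 1))) (by fun_prop))]
  -- For fixed `y`, the numerator is replaced by `(y + 1) x`, with Jacobian `y + 1`; `h` then no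
  -- longer depends on `y`, which can be integrated out after Tonelli.
  have hinner : ∀ y ∈ Set.Ioi (0 : ℝ), ENNReal.ofReal (r₂ * Real.exp (-(r₂ * y))) *
      ∫⁻ c, h (c / (y + 1)) ∂(expMeasure r₁) =
      ∫⁻ x in Set.Ioi 0, ENNReal.ofReal (r₁ * r₂ * Real.exp (-(r₁ * x)) *
        ((y + 1) * Real.exp (-((r₁ * x + r₂) * y)))) * h x := by
    intro y (hy : 0 < y)
    have hy1 : 0 < y + 1 := by positivity
    rw [lintegral_expMeasure (by fun_prop), lintegral_Ioi_comp_mul_left hy1,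
      ← lintegral_const_mul _ (by fun_prop)]
    refine setLIntegral_congr_fun measurableSet_Ioi fun x (hx : 0 < x) => ?_
    rw [mul_div_cancel_left₀ _ hy1.ne', ← mul_assoc, ← mul_assoc,
      ← ENNReal.ofReal_mul (by positivity), ← ENNReal.ofReal_mul (by positivity)]
    congr 2
    have : Real.exp (-((r₁ * x + r₂) * y)) * Real.exp (-(r₁ * x)) =
        Real.exp (-(r₂ * y)) * Real.exp (-(r₁ * ((y + 1) * x))) := by
      rw [← Real.exp_add, ← Real.exp_add]; ring_nf
    linear_combination (-(r₁ * r₂ * (y + 1))) * this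
  rw [setLIntegral_congr_fun measurableSet_Ioi hinner, lintegral_lintegral_swap
    (Measurable.aemeasurable (by unfold Function.uncurry; fun_prop))]
  refine setLIntegral_congr_fun measurableSet_Ioi fun x (hx : 0 < x) => ?_
  have hb : 0 < r₁ * x + r₂ := by positivity
  obtain ⟨hi, hv⟩ := integrableOn_and_integral_add_one_mul_exp hb
  rw [lintegral_mul_const _ (by fun_prop), ← hv, ← integral_const_mul,
    ofReal_integral_eq_lintegral_ofReal (hi.const_mul _)]
  filter_upwards [ae_restrict_mem measurableSet_Ioi] with y hy
  have : (0 : ℝ) < y := hy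
  simp only [Pi.zero_apply]
  positivity

lemma sinrPDF_eq {N : ℕ} (hN : 1 ≤ N) {gRE gJE x : ℝ} (hRE : 0 < gRE) (hJE : 0 < gJE)
    (hx : 0 < x) :
    sinrPDF N gRE gJE x = (1 / (N * gRE)) * (1 / (N * gJE)) * Real.exp (-(1 / (N * gRE) * x)) *
        (1 / (1 / (N * gRE) * x + 1 / (N * gJE)) +
          1 / (1 / (N * gRE) * x + 1 / (N * gJE)) ^ 2) := by
  have hN' : (0 : ℝ) < N := by exact_mod_cast hN
  have hd : 0 < gRE + gJE * x := by positivity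
  have h1 : 1 / (N * gRE) * x + 1 / (N * gJE) = (gRE + gJE * x) / (N * gRE * gJE) := by
    field_simp
    ring
  rw [sinrPDF, h1, show -(1 / (N * gRE) * x) = -(x / (N * gRE)) by ring]
  field_simp
  ring

lemma sinrPDF_nonneg (N : ℕ) {gRE gJE x : ℝ} (hRE : 0 < gRE) (hJE : 0 < gJE) (hx : 0 < x) :
    0 ≤ sinrPDF N gRE gJE x := by
  unfold sinrPDF; positivity

lemma integrableOn_sinrPDF {N : ℕ} (hN : 1 ≤ N) {gRE gJE : ℝ} (hRE : 0 < gRE) (hJE : 0 < gJE) :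
    IntegrableOn (sinrPDF N gRE gJE) (Set.Ioi 0) := by
  have hN' : (0 : ℝ) < N := by exact_mod_cast hN
  have hr : 0 < 1 / (N * gRE) := by positivity
  have h0 : IntegrableOn (fun x : ℝ => Real.exp (-(1 / (N * gRE) * x))) (Set.Ioi 0) := by
    simpa using integrableOn_rpow_mul_exp_neg_mul_rpow (p := 1) (s := 0) (b := 1 / (N * gRE))
      (by norm_num) one_pos hr
  refine Integrable.mono' (h0.const_mul ((1 / (N * gRE)) * (1 / (N * gJE)) *
    (1 / (1 / (N * gJE)) + 1 / (1 / (N * gJE)) ^ 2))) ?_ ?_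
  · exact Measurable.aestronglyMeasurable (by unfold sinrPDF; fun_prop)
  · filter_upwards [ae_restrict_mem measurableSet_Ioi] with x hx
    have hx' : (0 : ℝ) < x := hx
    rw [Real.norm_of_nonneg (sinrPDF_nonneg N hRE hJE hx), sinrPDF_eq hN hRE hJE hx, mul_right_comm]
    have h2 : 1 / (N * gJE) ≤ 1 / (N * gRE) * x + 1 / (N * gJE) := by
      have : 0 ≤ 1 / (N * gRE) * x := by positivity
      linarith
    gcongr

lemma hopCCDF_nonneg {m Ω g x : ℝ} (hm : 0 < m) (hΩ : 0 < Ω) (hg : 0 < g) (hx : 0 ≤ x) :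
    0 ≤ hopCCDF m Ω g x :=
  div_nonneg (upperGamma_nonneg (by positivity)) (Real.Gamma_pos_of_pos hm).le

lemma hopCCDF_le_one {m Ω g x : ℝ} (hm : 0 < m) (hΩ : 0 < Ω) (hg : 0 < g) (hx : 0 ≤ x) :
    hopCCDF m Ω g x ≤ 1 :=
  (div_le_one (Real.Gamma_pos_of_pos hm)).2 (upperGamma_le_Gamma hm (by positivity))

lemma continuousOn_hopCCDF {m Ω g : ℝ} (hm : 0 < m) (hΩ : 0 < Ω) (hg : 0 < g) :
    ContinuousOn (hopCCDF m Ω g) (Set.Ioi 0) := by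
  unfold hopCCDF
  refine ContinuousOn.div_const ((continuousOn_upperGamma hm).comp (by fun_prop) ?_) _
  intro x (hx : 0 < x)
  simp only [Set.mem_Ici]
  positivity

section Model

variable {N : ℕ} {mSR mRD ΩSR ΩRD gSR gRD gRE gJE : ℝ}

lemma ipIntegrand_nonneg (hmSR : 0 < mSR) (hmRD : 0 < mRD) (hΩSR : 0 < ΩSR)
    (hΩRD : 0 < ΩRD) (hSR : 0 < gSR) (hRD : 0 < gRD) (hRE : 0 < gRE) (hJE : 0 < gJE) {x : ℝ}
    (hx : 0 < x) : 0 ≤ ipIntegrand N mSR mRD ΩSR ΩRD gSR gRD gRE gJE x :=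
  mul_nonneg (mul_nonneg (hopCCDF_nonneg hmSR hΩSR hSR hx.le) (hopCCDF_nonneg hmRD hΩRD hRD hx.le))
    (sinrPDF_nonneg N hRE hJE hx)

lemma integrableOn_ipIntegrand (hN : 1 ≤ N) (hmSR : 0 < mSR) (hmRD : 0 < mRD) (hΩSR : 0 < ΩSR)
    (hΩRD : 0 < ΩRD) (hSR : 0 < gSR) (hRD : 0 < gRD) (hRE : 0 < gRE) (hJE : 0 < gJE) :
    IntegrableOn (ipIntegrand N mSR mRD ΩSR ΩRD gSR gRD gRE gJE) (Set.Ioi 0) := by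
  refine Integrable.bdd_mul (c := 1) (integrableOn_sinrPDF hN hRE hJE) ?_ ?_
  · exact ((continuousOn_hopCCDF hmSR hΩSR hSR).mul
      (continuousOn_hopCCDF hmRD hΩRD hRD)).aestronglyMeasurable measurableSet_Ioi
  · filter_upwards [ae_restrict_mem measurableSet_Ioi] with x (hx : 0 < x)
    have h1 := hopCCDF_nonneg hmSR hΩSR hSR hx.le
    have h2 := hopCCDF_nonneg hmRD hΩRD hRD hx.le
    rw [Real.norm_of_nonneg (mul_nonneg h1 h2)]
    exact mul_le_one₀ (hopCCDF_le_one hmSR hΩSR hSR hx.le) h2 (hopCCDF_le_one hmRD hΩRD hRD hx.le)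

/-- Monotonicity of the logarithm on positive arguments. The right side is a negation because the
complementary event has slices that are products of half-lines. -/
lemma secrecyCapacity_neg_iff {x y w : ℝ} (hx : 0 ≤ x) (hy : 0 ≤ y) (hw : 0 ≤ w) :
    secrecyCapacity x y w < 0 ↔ ¬(w ≤ x ∧ w ≤ y) := by
  have hm : 0 ≤ min x y := le_min hx hy
  rw [secrecyCapacity, sub_neg, Real.logb_lt_logb_iff one_lt_two (by linarith) (by linarith),
    add_lt_add_iff_left, ← not_le, le_min_iff]

/-- For a fixed eavesdropper pair the slice is `[x, ∞) × [x, ∞)` with `x` the SINR. Its measure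
depends on the pair only through `x`, so the density of the SINR reduces everything to one integral.
-/
lemma measure_sinr_le_snr (hN : 1 ≤ N) (hmSR : 0 < mSR) (hmRD : 0 < mRD) (hΩSR : 0 < ΩSR)
    (hΩRD : 0 < ΩRD) (hSR : 0 < gSR) (hRD : 0 < gRD) (hRE : 0 < gRE) (hJE : 0 < gJE) :
    (((gammaMeasure mSR (mSR / (ΩSR * gSR))).prod (gammaMeasure mRD (mRD / (ΩRD * gRD)))).prod
      ((expMeasure (1 / (N * gRE))).prod (expMeasure (1 / (N * gJE)))))
        {p | p.2.1 / (p.2.2 + 1) ≤ p.1.1 ∧ p.2.1 / (p.2.2 + 1) ≤ p.1.2} =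
      ENNReal.ofReal (∫ x in Set.Ioi 0, ipIntegrand N mSR mRD ΩSR ΩRD gSR gRD gRE gJE x) := by
  have hN' : (0 : ℝ) < N := by exact_mod_cast hN
  have hr₁ : 0 < 1 / (N * gRE) := by positivity
  have hr₂ : 0 < 1 / (N * gJE) := by positivity
  have hrSR : 0 < mSR / (ΩSR * gSR) := by positivity
  have hrRD : 0 < mRD / (ΩRD * gRD) := by positivity
  have := isProbabilityMeasure_gammaMeasure hmSR hrSR
  have := isProbabilityMeasure_gammaMeasure hmRD hrRD
  have := isProbabilityMeasure_expMeasure hr₁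
  have := isProbabilityMeasure_expMeasure hr₂
  have hset : MeasurableSet {p : (ℝ × ℝ) × (ℝ × ℝ) |
      p.2.1 / (p.2.2 + 1) ≤ p.1.1 ∧ p.2.1 / (p.2.2 + 1) ≤ p.1.2} := by
    have h1 : Measurable fun p : (ℝ × ℝ) × (ℝ × ℝ) => p.2.1 / (p.2.2 + 1) := by fun_prop
    exact (measurableSet_le h1 (by fun_prop)).inter (measurableSet_le h1 (by fun_prop))
  have hmeas : ∀ (a r : ℝ), Measurable fun x => gammaMeasure a r (Set.Ici x) := fun a r =>
    Antitone.measurable fun x y hxy => measure_mono (Set.Ici_subset_Ici.2 hxy)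
  rw [Measure.prod_apply_symm hset]
  have hslice : ∀ q : ℝ × ℝ, ((gammaMeasure mSR (mSR / (ΩSR * gSR))).prod
      (gammaMeasure mRD (mRD / (ΩRD * gRD)))) ((fun p => (p, q)) ⁻¹' {p : (ℝ × ℝ) × (ℝ × ℝ) |
      p.2.1 / (p.2.2 + 1) ≤ p.1.1 ∧ p.2.1 / (p.2.2 + 1) ≤ p.1.2}) =
      (fun x => gammaMeasure mSR (mSR / (ΩSR * gSR)) (Set.Ici x) *
        gammaMeasure mRD (mRD / (ΩRD * gRD)) (Set.Ici x)) (q.1 / (q.2 + 1)) := by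
    intro q
    simp only
    rw [← Measure.prod_prod]
    rfl
  simp_rw [hslice]
  rw [lintegral_exp_div_exp_add_one hr₁ hr₂
      (h := fun x => gammaMeasure mSR (mSR / (ΩSR * gSR)) (Set.Ici x) *
        gammaMeasure mRD (mRD / (ΩRD * gRD)) (Set.Ici x)) ((hmeas _ _).mul (hmeas _ _)),
    ofReal_integral_eq_lintegral_ofReal
      (integrableOn_ipIntegrand hN hmSR hmRD hΩSR hΩRD hSR hRD hRE hJE)]
  · refine setLIntegral_congr_fun measurableSet_Ioi fun x (hx : 0 < x) => ?_
    have h1 := hopCCDF_nonneg hmSR hΩSR hSR hx.le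
    have h2 := hopCCDF_nonneg hmRD hΩRD hRD hx.le
    rw [← sinrPDF_eq hN hRE hJE hx, gammaMeasure_Ici hmSR hrSR hx.le,
      gammaMeasure_Ici hmRD hrRD hx.le, ← hopCCDF, ← hopCCDF, ← ENNReal.ofReal_mul h1,
      ← ENNReal.ofReal_mul (sinrPDF_nonneg N hRE hJE hx), ipIntegrand, mul_comm]
  · filter_upwards [ae_restrict_mem measurableSet_Ioi] with x hx
    exact ipIntegrand_nonneg hmSR hmRD hΩSR hΩRD hSR hRD hRE hJE hx

theorem measureReal_secrecyCapacity_neg {S : Type*} [MeasurableSpace S] (P : Measure S)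
    [IsProbabilityMeasure P] {γSR γRD ΓRE ΓJE : S → ℝ} (hN : 1 ≤ N) (hmSR : 0 < mSR)
    (hmRD : 0 < mRD) (hΩSR : 0 < ΩSR) (hΩRD : 0 < ΩRD) (hSR : 0 < gSR) (hRD : 0 < gRD)
    (hRE : 0 < gRE) (hJE : 0 < gJE)
    (lSR : HasLaw γSR (gammaMeasure mSR (mSR / (ΩSR * gSR))) P)
    (lRD : HasLaw γRD (gammaMeasure mRD (mRD / (ΩRD * gRD))) P)
    (lRE : HasLaw ΓRE (expMeasure (1 / (N * gRE))) P)
    (lJE : HasLaw ΓJE (expMeasure (1 / (N * gJE))) P)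
    (hind : iIndepFun ![γSR, γRD, ΓRE, ΓJE] P) :
    P.real {ω | secrecyCapacity (γSR ω) (γRD ω) (ΓRE ω / (ΓJE ω + 1)) < 0} =
      interceptProb N mSR mRD ΩSR ΩRD gSR gRD gRE gJE := by
  have hmeas : ∀ i, AEMeasurable ((![γSR, γRD, ΓRE, ΓJE] : Fin 4 → S → ℝ) i) P := by
    intro i
    fin_cases i
    exacts [lSR.aemeasurable, lRD.aemeasurable, lRE.aemeasurable, lJE.aemeasurable]
  have i₁ : IndepFun γSR γRD P := hind.indepFun (i := 0) (j := 1) (by decide)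
  have i₂ : IndepFun ΓRE ΓJE P := hind.indepFun (i := 2) (j := 3) (by decide)
  have i₃ : IndepFun (fun ω => (γSR ω, γRD ω)) (fun ω => (ΓRE ω, ΓJE ω)) P :=
    hind.indepFun_prodMk_prodMk₀ hmeas 0 1 2 3 (by decide) (by decide) (by decide) (by decide)
  have law := i₃.hasLaw_prod (i₁.hasLaw_prod lSR lRD) (i₂.hasLaw_prod lRE lJE)
  have hset : MeasurableSet {p : (ℝ × ℝ) × (ℝ × ℝ) |
      p.2.1 / (p.2.2 + 1) ≤ p.1.1 ∧ p.2.1 / (p.2.2 + 1) ≤ p.1.2} := by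
    have h1 : Measurable fun p : (ℝ × ℝ) × (ℝ × ℝ) => p.2.1 / (p.2.2 + 1) := by fun_prop
    exact (measurableSet_le h1 (by fun_prop)).inter (measurableSet_le h1 (by fun_prop))
  have hP := law.measure_eq hset
  rw [measure_sinr_le_snr hN hmSR hmRD hΩSR hΩRD hSR hRD hRE hJE] at hP
  have hnn : 0 ≤ ∫ x in Set.Ioi 0, ipIntegrand N mSR mRD ΩSR ΩRD gSR gRD gRE gJE x :=
    setIntegral_nonneg measurableSet_Ioi fun x hx =>
      ipIntegrand_nonneg hmSR hmRD hΩSR hΩRD hSR hRD hRE hJE hx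
  -- The two events are compared only almost everywhere, since the logarithmic comparison uses
  -- nonnegative values. An exponential law is a Gamma law of shape one, so one lemma covers all
  -- four variables.
  have hae : {ω | secrecyCapacity (γSR ω) (γRD ω) (ΓRE ω / (ΓJE ω + 1)) < 0} =ᵐ[P]
      ({ω | ΓRE ω / (ΓJE ω + 1) ≤ γSR ω ∧ ΓRE ω / (ΓJE ω + 1) ≤ γRD ω}ᶜ : Set S) := by
    have hnonneg : Measurable fun x : ℝ => 0 ≤ x := measurableSet_setOfPred.1 measurableSet_Ici
    filter_upwards [(lSR.ae_iff hnonneg).2 (ae_nonneg_gammaMeasure _ _),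
      (lRD.ae_iff hnonneg).2 (ae_nonneg_gammaMeasure _ _),
      (lRE.ae_iff hnonneg).2 (ae_nonneg_gammaMeasure _ _),
      (lJE.ae_iff hnonneg).2 (ae_nonneg_gammaMeasure _ _)] with ω h1 h2 h3 h4
    exact propext (secrecyCapacity_neg_iff h1 h2 (by positivity))
  have hnull : NullMeasurableSet
      {ω | ΓRE ω / (ΓJE ω + 1) ≤ γSR ω ∧ ΓRE ω / (ΓJE ω + 1) ≤ γRD ω} P :=
    law.aemeasurable.nullMeasurableSet_preimage hset
  rw [measureReal_congr hae, probReal_compl_eq_one_sub₀ hnull, interceptProb, measureReal_def, hP,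
    ENNReal.toReal_ofReal hnn]

end Model

/-! ### The series representation of the intercept probability -/

section Representation

variable {N : ℕ} {mSR mRD ΩSR ΩRD gSR gRD gRE gJE : ℝ}

/-- The substitution `x = (gRE / gJE) u` turns `gRE + gJE x` into `gRE (1 + u)`. -/
lemma integral_ipIntegrand (hN : 1 ≤ N) (hRE : 0 < gRE) (hJE : 0 < gJE) :
    ∫ x in Set.Ioi 0, ipIntegrand N mSR mRD ΩSR ΩRD gSR gRD gRE gJE x =
      1 / (Real.Gamma mSR * Real.Gamma mRD) * ∫ u in Set.Ioi 0,
        sinrKernel (1 / (N * gJE)) u * (upperGamma mSR (mSR * gRE / (ΩSR * gSR * gJE) * u) *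
          upperGamma mRD (mRD * gRE / (ΩRD * gRD * gJE) * u)) := by
  have hN' : (0 : ℝ) < N := by exact_mod_cast hN
  have hb : 0 < gRE / gJE := by positivity
  have h := integral_comp_mul_left_Ioi (ipIntegrand N mSR mRD ΩSR ΩRD gSR gRD gRE gJE) 0 hb
  rw [mul_zero, smul_eq_mul, eq_inv_mul_iff_mul_eq₀ hb.ne'] at h
  rw [← h, ← integral_const_mul, ← integral_const_mul]
  refine setIntegral_congr_fun measurableSet_Ioi fun u (hu : 0 < u) => ?_
  have hu1 : 0 < 1 + u := by positivity
  have h1 : gRE / gJE * sinrPDF N gRE gJE (gRE / gJE * u) = sinrKernel (1 / (N * gJE)) u := by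
    have e1 : gRE + gJE * (gRE / gJE * u) = gRE * (1 + u) := by field_simp
    have e2 : gRE / gJE * u / (N * gRE) = 1 / (N * gJE) * u := by field_simp
    have e3 : gJE * N * gRE + gRE + gJE * (gRE / gJE * u) = gRE * (gJE * N + (1 + u)) := by
      field_simp; ring
    rw [sinrPDF, sinrKernel, e1, e2, e3]
    field_simp
    ring
  have h2 : ∀ m Ω g : ℝ, m / (Ω * g) * (gRE / gJE * u) = m * gRE / (Ω * g * gJE) * u := by
    intro m Ω g
    rw [← mul_assoc, div_mul_div_comm]
  rw [← h1, ipIntegrand, hopCCDF, hopCCDF, h2, h2]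
  ring

lemma ipTerm_eq_integral_barnesTerm {c₁ c₂ : ℝ} (hN : 1 ≤ N) (hmSR : 0 < mSR) (hmRD : 0 < mRD)
    (hΩSR : 0 < ΩSR) (hΩRD : 0 < ΩRD) (hSR : 0 < gSR) (hRD : 0 < gRD) (hRE : 0 < gRE)
    (hJE : 0 < gJE) (hc₁ : 0 < c₁) (hc₂ : 0 < c₂) (hc : c₁ + c₂ < 1) (l : ℕ) :
    ipTerm c₁ c₂ N mSR mRD ΩSR ΩRD gSR gRD gRE gJE l =
      (1 / (2 * Real.pi) ^ 2 : ℂ) * ∫ t, barnesTerm mSR mRD c₁ c₂ (mSR * gRE / (ΩSR * gSR * gJE))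
        (mRD * gRE / (ΩRD * gRD * gJE)) (1 / (N * gJE)) l t := by
  have hN' : (0 : ℝ) < N := by exact_mod_cast hN
  rw [integral_barnesTerm hmSR hmRD hc₁ hc₂ hc (by positivity) (by positivity) (by positivity),
    ipTerm, show Finset.Icc 1 2 = {1, 2} from rfl, Finset.sum_pair (by norm_num),
    Finset.sum_pair (by norm_num)]
  have h1 : ∀ m Ω g : ℝ, m * gRE / (Ω * g * gJE) * (1 / (N * gJE))⁻¹ = N * m * gRE / (Ω * g) := by
    intro m Ω g
    rw [one_div, inv_inv, mul_comm (Ω * g), ← div_div, div_mul_eq_mul_div]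
    congr 1
    field_simp
  rw [h1, h1]
  have h2 : (-1 / ((N : ℂ) * gJE)) = -((1 / (N * gJE) : ℝ) : ℂ) := by
    push_cast; ring
  rw [h2]
  push_cast
  simp only [pow_one, pow_zero, mul_one, one_mul]
  ring

end Representation

theorem proposition1 (M N b₁ b₂ : ℕ) (hM : 1 ≤ M) (hN : 1 ≤ N) (hb₁ : 1 ≤ b₁) (hb₂ : 1 ≤ b₂)
    (gSR gRD gRE gJE : ℝ) (hSR : 0 < gSR) (hRD : 0 < gRD) (hRE : 0 < gRE) (hJE : 0 < gJE)
    (mSR mRD ΩSR ΩRD : ℝ)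
    (hmSR : mSR = shapeParam M b₁) (hmRD : mRD = shapeParam N b₂)
    (hΩSR : ΩSR = fadingPower M b₁) (hΩRD : ΩRD = fadingPower N b₂)
    -- the Mellin–Barnes contours `Re s = c₁` and `Re v = c₂`
    (c₁ c₂ : ℝ) (hc₁ : 0 < c₁) (hc₂ : 0 < c₂) (hc : c₁ + c₂ < 1) :
    -- `interceptProb` is the probability of `C_s < 0` in the Gamma / Exponential model
    (∀ {S : Type*} [MeasurableSpace S] (P : Measure S) [IsProbabilityMeasure P]
        (γSR γRD ΓRE ΓJE : S → ℝ),
        HasLaw γSR (gammaMeasure mSR (mSR / (ΩSR * gSR))) P →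
        HasLaw γRD (gammaMeasure mRD (mRD / (ΩRD * gRD))) P →
        HasLaw ΓRE (expMeasure (1 / (N * gRE))) P →
        HasLaw ΓJE (expMeasure (1 / (N * gJE))) P →
        iIndepFun ![γSR, γRD, ΓRE, ΓJE] P →
        P.real {ω | secrecyCapacity (γSR ω) (γRD ω) (ΓRE ω / (ΓJE ω + 1)) < 0} =
          interceptProb N mSR mRD ΩSR ΩRD gSR gRD gRE gJE) ∧
    -- all integrals and the series converge absolutely
    IntegrableOn (ipIntegrand N mSR mRD ΩSR ΩRD gSR gRD gRE gJE) (Set.Ioi 0) ∧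
    (∀ l : ℕ, ∀ k ∈ Finset.Icc 1 2,
      Integrable (foxHLineIntegrand c₁ c₂ (Lambda1 mSR mRD k l)
        (mSR * gRE / (ΩSR * gSR * gJE)) (mRD * gRE / (ΩRD * gRD * gJE))) ∧
      Integrable (foxHLineIntegrand c₁ c₂ (Lambda2 mSR mRD k l)
        (N * mSR * gRE / (ΩSR * gSR)) (N * mRD * gRE / (ΩRD * gRD)))) ∧
    Summable (ipTerm c₁ c₂ N mSR mRD ΩSR ΩRD gSR gRD gRE gJE) ∧
    -- the series representation
    (interceptProb N mSR mRD ΩSR ΩRD gSR gRD gRE gJE : ℂ) =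
      1 - 1 / (Complex.Gamma mSR * Complex.Gamma mRD) *
        ∑' l : ℕ, ipTerm c₁ c₂ N mSR mRD ΩSR ΩRD gSR gRD gRE gJE l := by

  have hmSR0 : 0 < mSR := hmSR ▸ shapeParam_pos hM hb₁
  have hmRD0 : 0 < mRD := hmRD ▸ shapeParam_pos hN hb₂
  have hΩSR0 : 0 < ΩSR := hΩSR ▸ fadingPower_pos hM hb₁
  have hΩRD0 : 0 < ΩRD := hΩRD ▸ fadingPower_pos hN hb₂
  have hN' : (0 : ℝ) < N := by exact_mod_cast hN
  have hx : 0 < mSR * gRE / (ΩSR * gSR * gJE) := by positivity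
  have hy : 0 < mRD * gRE / (ΩRD * gRD * gJE) := by positivity
  have hz : 0 < 1 / (N * gJE) := by positivity
  have hsum := hasSum_integral_barnesTerm hmSR0 hmRD0 hc₁ hc₂ hc hx hy hz
  simp_rw [← ipTerm_eq_integral_barnesTerm hN hmSR0 hmRD0 hΩSR0 hΩRD0 hSR hRD hRE hJE hc₁ hc₂ hc]
    at hsum
  refine ⟨?_, integrableOn_ipIntegrand hN hmSR0 hmRD0 hΩSR0 hΩRD0 hSR hRD hRE hJE, ?_,
    hsum.summable, ?_⟩
  · intro S _ P _ γSR γRD ΓRE ΓJE lSR lRD lRE lJE hind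
    exact measureReal_secrecyCapacity_neg P hN hmSR0 hmRD0 hΩSR0 hΩRD0 hSR hRD hRE hJE
      lSR lRD lRE lJE hind
  · intro l k hk
    exact ⟨integrable_foxHLineIntegrand_Lambda1 hmSR0 hmRD0 hc₁ hc₂ hc hx hy hk l,
      integrable_foxHLineIntegrand_Lambda2 hmSR0 hmRD0 hc₁ hc₂ hc (by positivity) (by positivity)
        (Finset.mem_Icc.1 hk).1 l⟩
  · rw [hsum.tsum_eq, interceptProb, integral_ipIntegrand hN hRE hJE, Complex.ofReal_sub,
      Complex.ofReal_mul, ← integral_complex_ofReal, Complex.Gamma_ofReal, Complex.Gamma_ofReal]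
    push_cast
    rfl
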